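/- Let $D\ge 2$, let $\mathbb X=\{a_1<\dots<a_D\}$ be a finite ordered alphabet, let $\mathbb X^*$ be the set of finite strings over $\mathbb X$, and let $X_i(x)=x_i$ be the coordinates on the space $\mathbb X^{\mathbb Z}$ of two-sided sequences with its product $\sigma$-field and the shift $T((x_i)_i)=(x_{i+1})_i$. Write $x_j^k=x_j\cdots x_k$. For a probability measure $P$ on $\mathbb X^{\mathbb Z}$ write $P(w)=P(X_1^{|w|}=w)$ and $P(a\mid w)=P(wa)/P(w)$ (with value $0$ if $P(w)=0$); $P$ is stationary ergodic if it is $T$-invariant and gives every $T$-invariant event probability $0$ or $1$. *Computability.* A real function $g$ of a finite object is computable if the sets of rationals below and above $g(\cdot)$ are computably enumerable (c.e.) uniformly in the argument; computability of a function with an additional argument $s\in\mathbb X^{\mathbb Z}$ is understood with $s$ as an oracle, uniformly in $s$. A probability measure $P$ on $\mathbb X^{\mathbb Z}$ is computable if $(\sigma,\tau)\mapsto P(X_{-|\sigma|+1}^{|\tau|}=\sigma\tau)$, $\sigma,\tau\in\mathbb X^*$, is computable. A sequence $s\in\mathbb X^{\mathbb Z}$ is a representation of $P$ if $P=\rho(s)$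 for some map $\rho$ from $\mathbb X^{\mathbb Z}$ to probability measures on $\mathbb X^{\mathbb Z}$ such that $(\sigma,\tau,s)\mapsto\rho(s)(X_{-|\sigma|+1}^{|\tau|}=\sigma\tau)$ is computable. *Randomness.* A Martin-Löf $(s,P)$-test is a sequence of events $U_i=\{x:\exists(\sigma,\tau)\in V_i,\ x_{-|\sigma|+1}^{|\tau|}=\sigma\tau\}$, $i\ge1$, where the sets $V_i\subset\mathbb X^*\times\mathbb X^*$ are uniformly c.e. with oracle $s$ and $P(U_i)\le 2^{-i}$ for all $i\ge 1$. A point $x$ is $1$-$P$-random if there is a representation $s$ of $P$ such that $x\notin\bigcap_{i\ge1}U_i$ for every Martin-Löf $(s,P)$-test $(U_i)_{i\ge 1}$. *Estimators and predictors.* A probability measure $R$ on $\mathbb X^{\mathbb Z}$ is a $1$-universal forward estimator if $R$ is computable and, for every stationary ergodic $P$ and every $1$-$P$-random point $x$, $$\lim_{n\to\infty}\frac1n\sum_{i=0}^{n-1}\sum_{a\in\mathbb X}\bigl|R(a\mid x_1^i)-P(a\mid x_1^i)\bigr|=0 .$$ The predictor $f_R:\mathbb X^*\to\mathbb X$ induced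 by $R$ maps $w$ to the least $a\in\mathbb X$ that maximizes $R(a\mid w)$. A predictor $f:\mathbb X^*\to\mathbb X$ is $1$-universal if it is computable and, for every stationary ergodic $P$ and every $1$-$P$-random point $x$, $$\lim_{n\to\infty}\frac1n\sum_{i=0}^{n-1}\mathbf 1\{x_{i+1}\ne f(x_1^i)\}=u_P:=\lim_{n\to\infty}\mathbf E_P\Bigl[1-\max_{a\in\mathbb X}P(X_0=a\mid X_{-n}^{-1})\Bigr],$$ where the limit that defines $u_P$ exists. **Theorem.** If $R$ is a $1$-universal forward estimator and the induced predictor $f_R$ is computable, then $f_R$ is a $1$-universal predictor. -/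

import Mathlib

namespace UniversalPrediction

open Filter Topology MeasureTheory

/-- Two-sided infinite sequences over the ordered alphabet `a₁ < ... < a_D`, modelled as `Fin D`. -/
abbrev BiSeq (D : ℕ) : Type := ℤ → Fin D

variable {D : ℕ}

/-- `block x j n` is the string `x_j x_{j+1} ... x_{j+n-1}` of length `n`. -/
def block (x : BiSeq D) (j : ℤ) (n : ℕ) : List (Fin D) :=
  (List.range n).map fun i => x (j + (i : ℤ))

/-- The shift `(x_i) ↦ (x_{i+1})`. -/
def shift (x : BiSeq D) : BiSeq D := fun i => x (i + 1)

/-- The set of points `x` with `x_{-|σ|+1} ... x_{|τ|} = στ`. -/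
def cylinder (σ τ : List (Fin D)) : Set (BiSeq D) :=
  {x | block x (-(σ.length : ℤ) + 1) (σ.length + τ.length) = σ ++ τ}

/-! ### Computability -/

/-- The rational number `(a - b) / (c + 1)` with code `(a, b, c)`; every rational has a code. -/
def ratOfCode (t : ℕ × ℕ × ℕ) : ℚ := ((t.1 : ℚ) - (t.2.1 : ℚ)) / ((t.2.2 : ℚ) + 1)

/-- `a ∈ W^s`, where `W` is a set of axioms `(w, a)`: the finite portion `w = s_{-k} ... s_k` of
the oracle `s` puts `a` into the enumerated set. -/
def OracleEnum {α : Type*} (W : List (Fin D) × α → Prop) (s : BiSeq D) (a : α) : Prop :=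
  ∃ k : ℕ, W (block s (-(k : ℤ)) (2 * k + 1), a)

/-- `A` is computably enumerable with oracle `s`: it is `W^s` for a c.e. set `W` of axioms. -/
def CEIn {α : Type*} [Primcodable α] (s : BiSeq D) (A : α → Prop) : Prop :=
  ∃ W : List (Fin D) × α → Prop, REPred W ∧ ∀ a, A a ↔ OracleEnum W s a

/-- `A s` is computably enumerable with oracle `s`, by one algorithm for all oracles `s`. -/
def UniformlyCE {α : Type*} [Primcodable α] (A : BiSeq D → α → Prop) : Prop :=
  ∃ W : List (Fin D) × α → Prop, REPred W ∧ ∀ s a, A s a ↔ OracleEnum W s a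

/-- A computable real function on a set of finite objects: rational lower bounds and rational upper
bounds of `f a` can be enumerated uniformly in `a`; equivalently, `f a` can be computed to any
prescribed precision. (For a single real this says exactly that its left cut is decidable. Demanding
a uniform decision of `q < f a`, also at `q = f a`, would leave some measures without any
representation.) -/
def ComputableReal {α : Type*} [Primcodable α] (f : α → ℝ) : Prop :=
  REPred (fun p : α × (ℕ × ℕ × ℕ) => (ratOfCode p.2 : ℝ) < f p.1) ∧
  REPred (fun p : α × (ℕ × ℕ × ℕ) => f p.1 < (ratOfCode p.2 : ℝ))

/-- A computable real function of a finite object `a` and an infinite sequence `s`: as above,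
by one algorithm that has the sequence `s` as an oracle. -/
def ComputableRealOracle {α : Type*} [Primcodable α] (f : α → BiSeq D → ℝ) : Prop :=
  UniformlyCE (fun s (p : α × (ℕ × ℕ × ℕ)) => (ratOfCode p.2 : ℝ) < f p.1 s) ∧
  UniformlyCE (fun s (p : α × (ℕ × ℕ × ℕ)) => f p.1 s < (ratOfCode p.2 : ℝ))

/-- A computable probability measure. -/
def ComputableMeasure (R : ProbabilityMeasure (BiSeq D)) : Prop :=
  ComputableReal fun p : List (Fin D) × List (Fin D) =>
    (R : Measure (BiSeq D)).real (cylinder p.1 p.2)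

/-- A representation function. -/
def IsRepresentationFunction (ρ : BiSeq D → ProbabilityMeasure (BiSeq D)) : Prop :=
  ComputableRealOracle fun (p : List (Fin D) × List (Fin D)) s =>
    (ρ s : Measure (BiSeq D)).real (cylinder p.1 p.2)

/-- The sequence `s` is a representation of the measure `P`. -/
def IsRepresentation (s : BiSeq D) (P : ProbabilityMeasure (BiSeq D)) : Prop :=
  ∃ ρ : BiSeq D → ProbabilityMeasure (BiSeq D), IsRepresentationFunction ρ ∧ ρ s = P

/-! ### Martin-Löf randomness -/

/-- The events `U 1, U 2, ...` are uniformly c.e. with oracle `s` (the index `0` is not used). -/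
def UniformlyCEEvents (s : BiSeq D) (U : ℕ → Set (BiSeq D)) : Prop :=
  ∃ V : ℕ → Set (List (Fin D) × List (Fin D)),
    (∀ i, 1 ≤ i → U i = {x | ∃ p ∈ V i, x ∈ cylinder p.1 p.2}) ∧
    CEIn s (fun q : ℕ × (List (Fin D) × List (Fin D)) => q.2 ∈ V q.1)

/-- Martin-Löf `(s, P)`-tests. -/
def IsMartinLofTest (s : BiSeq D) (P : ProbabilityMeasure (BiSeq D)) (U : ℕ → Set (BiSeq D)) : Prop :=
  UniformlyCEEvents s U ∧ ∀ n, 1 ≤ n → (P : Measure (BiSeq D)).real (U n) ≤ (2 : ℝ)⁻¹ ^ n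

/-- `1`-`(s, P)`-random points. -/
def IsOneRandomWith (s : BiSeq D) (P : ProbabilityMeasure (BiSeq D)) (x : BiSeq D) : Prop :=
  ∀ U : ℕ → Set (BiSeq D), IsMartinLofTest s P U → ¬ ∀ i, 1 ≤ i → x ∈ U i

/-- `1`-`P`-random points. -/
def IsOneRandom (P : ProbabilityMeasure (BiSeq D)) (x : BiSeq D) : Prop :=
  ∃ s : BiSeq D, IsRepresentation s P ∧ IsOneRandomWith s P x

/-! ### Estimation and prediction -/

/-- Stationary ergodic measures. -/
def StationaryErgodic (P : ProbabilityMeasure (BiSeq D)) : Prop :=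
  Ergodic (shift : BiSeq D → BiSeq D) (P : Measure (BiSeq D))

/-- The probability that the string `w` occurs at the positions `j, ..., j + |w| - 1`. -/
noncomputable def blockProb (P : ProbabilityMeasure (BiSeq D)) (j : ℤ) (w : List (Fin D)) : ℝ :=
  (P : Measure (BiSeq D)).real {x | block x j w.length = w}

/-- The conditional probability of the letter `a` at position `j + |w|`, given that `w` occurs at
the positions `j, ..., j + |w| - 1`; it is `0` if the condition has probability zero. -/
noncomputable def condProb (P : ProbabilityMeasure (BiSeq D)) (j : ℤ) (w : List (Fin D))
    (a : Fin D) : ℝ :=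
  blockProb P j (w ++ [a]) / blockProb P j w

/-- `R` is a `1`-universal forward estimator. -/
def IsOneUniversalForwardEstimator (R : ProbabilityMeasure (BiSeq D)) : Prop :=
  ComputableMeasure R ∧
  ∀ P : ProbabilityMeasure (BiSeq D), StationaryErgodic P → ∀ x : BiSeq D, IsOneRandom P x →
    Tendsto (fun n : ℕ => (1 / (n : ℝ)) * ∑ i ∈ Finset.range n, ∑ a : Fin D,
      |condProb R 1 (block x 1 i) a - condProb P 1 (block x 1 i) a|) atTop (𝓝 0)

/-- The least maximizer of `g`. -/
noncomputable def argmax [NeZero D] (g : Fin D → ℝ) : Fin D :=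
  open Classical in
  (Finset.univ.filter fun a => ∀ b, g b ≤ g a).min' (by
    obtain ⟨a, ha⟩ := Finite.exists_max g
    exact ⟨a, by simpa using ha⟩)

/-- The predictor induced by `R`. -/
noncomputable def inducedPredictor [NeZero D] (R : ProbabilityMeasure (BiSeq D)) :
    List (Fin D) → Fin D :=
  fun w => argmax (condProb R 1 w)

/-- `u` is the unpredictability rate of `P`, that is, the limit of the expectations of
`1 - max_a P(X_0 = a | X_{-n}, ..., X_{-1})`. -/
def IsUnpredictabilityRate (P : ProbabilityMeasure (BiSeq D)) (u : ℝ) : Prop :=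
  Tendsto (fun n : ℕ => ∫ x, (1 - ⨆ a : Fin D, condProb P (-(n : ℤ)) (block x (-(n : ℤ)) n) a)
    ∂(P : Measure (BiSeq D))) atTop (𝓝 u)

/-- `f` is a `1`-universal predictor; the existence of the unpredictability rate is included. -/
def IsOneUniversalPredictor (f : List (Fin D) → Fin D) : Prop :=
  Computable f ∧
  ∀ P : ProbabilityMeasure (BiSeq D), StationaryErgodic P →
    ∃ u : ℝ, IsUnpredictabilityRate P u ∧ ∀ x : BiSeq D, IsOneRandom P x →
      Tendsto (fun n : ℕ => (1 / (n : ℝ)) * ∑ i ∈ Finset.range n,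
        (if x ((i : ℤ) + 1) ≠ f (block x 1 i) then (1 : ℝ) else 0)) atTop (𝓝 u)

end UniversalPrediction

/-!
By Lévy's theorem `max_a P(X_0 = a | X_{-n}, ..., X_{-1})` converges almost surely to some `G`, and
`u_P = 1 - ∫ G`. Let `x` be random with respect to the representation `s` of `P`.

The numbers `max_a P(a | x_1^i)` average to `∫ G`, as in Breiman's ergodic theorem. For this it is
enough to bound, for each threshold `c`, how often `max_a P(a | x_1^i) > c`. If `i ≥ k`, the orbit
of `x` is then at a point at which some past of length at least `k` gives a letter a probability
above `c`. These points form an open set `V` that is c.e. with oracle `s`, and as `k → ∞` its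
probability decreases to that of the corresponding upper limit. Let `q` exceed the probability of
`V`. By the maximal ergodic theorem the open set `U` of the points for which some visit frequency
of `V` exceeds `q` has probability less than one, and a random orbit leaves every c.e. open set of
probability less than one, so the visit frequencies of `x` are eventually at most about `q`.
The orbit leaves `U` for the following reason. By the mean ergodic theorem one can find, effectively
for each string `w`, an `n` such that the number of visits to `w` during `n` steps has second moment
close to `(n P(w))²`; by the Cauchy-Schwarz inequality the event that `w` occurs and is followed by
`n` steps inside `U` has probability at most `r P(w)` with a fixed `r < 1`. Iterating this gives a
Martin-Löf test.

The conditional probabilities of the predicted letters minus the indicators of correct predictions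
are martingale differences, so by the Azuma-Hoeffding inequality large values of their averages have
exponentially small probability. The predictors `f + k` with `k : Fin D` share out all the letters,
which turns the resulting one-sided bounds into two-sided ones.

Finally, if `R(· | x_1^i)` is close to `P(· | x_1^i)`, then a maximizer of the former has nearly the
maximal conditional probability.
-/

namespace UniversalPrediction

open Filter Topology MeasureTheory

variable {D : ℕ}

section Block

theorem block_eq_map (x : BiSeq D) (j : ℤ) (n : ℕ) :
    block x j n = (List.range n).map fun i : ℕ => x (j + (i : ℤ)) := by
  simp [block, ← List.map_eq_flatMap, List.map_map, Function.comp_def]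

theorem block_add (x : BiSeq D) (j : ℤ) (m n : ℕ) :
    block x j (m + n) = block x j m ++ block x (j + m) n := by
  simp only [block_eq_map, List.range_add, List.map_append, List.map_map]
  congr 1
  exact List.map_congr_left fun i _ => by simp [add_assoc]

@[simp] theorem length_block (x : BiSeq D) (j : ℤ) (n : ℕ) : (block x j n).length = n := by
  simp [block]

@[simp] theorem block_one (x : BiSeq D) (j : ℤ) : block x j 1 = [x j] := by
  simp [block]

theorem block_succ (x : BiSeq D) (j : ℤ) (n : ℕ) :
    block x j (n + 1) = block x j n ++ [x (j + n)] := by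
  rw [block_add, block_one]

theorem iterate_shift_apply (x : BiSeq D) (n : ℕ) (i : ℤ) : shift^[n] x i = x (i + n) := by
  induction n generalizing x with
  | zero => simp
  | succ n ih =>
    rw [Function.iterate_succ_apply, ih, shift]
    congr 1
    push_cast
    ring

theorem block_iterate_shift (x : BiSeq D) (n : ℕ) (j : ℤ) (m : ℕ) :
    block (shift^[n] x) j m = block x (j + n) m := by
  simp only [block_eq_map, iterate_shift_apply, add_right_comm]

theorem take_drop_block (x : BiSeq D) (j : ℤ) {k m n : ℕ} (h : k + m ≤ n) :
    ((block x j n).drop k).take m = block x (j + k) m := by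
  obtain ⟨r, rfl⟩ := Nat.exists_eq_add_of_le h
  rw [block_add, block_add, List.append_assoc, List.drop_left' (length_block x j k),
    List.take_left' (length_block _ _ _)]

/-- The central segment `x_{-k} ... x_k` of a sequence: this is both what a computation with the
oracle `x` can read within `k` steps, and a basic neighbourhood of the point `x`. -/
def segment (x : BiSeq D) (k : ℕ) : List (Fin D) := block x (-(k : ℤ)) (2 * k + 1)

/-- The part of radius `m` around position `i` of a string whose letters are numbered from its
middle; it is meaningful for `i + m ≤ u.length / 2`. -/
def subsegment (i m : ℕ) (u : List (Fin D)) : List (Fin D) :=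
  (u.drop (u.length / 2 + i - m)).take (2 * m + 1)

@[simp] theorem length_segment (x : BiSeq D) (k : ℕ) : (segment x k).length = 2 * k + 1 :=
  length_block _ _ _

theorem half_length_segment (x : BiSeq D) (k : ℕ) : (segment x k).length / 2 = k := by
  rw [length_segment]
  omega

theorem subsegment_segment (x : BiSeq D) {i m k : ℕ} (h : i + m ≤ k) :
    subsegment i m (segment x k) = segment (shift^[i] x) m := by
  rw [subsegment, half_length_segment, segment, take_drop_block x _ (by omega), segment,
    block_iterate_shift]
  congr 1
  omega

theorem subsegment_zero_segment (x : BiSeq D) {m k : ℕ} (h : m ≤ k) :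
    subsegment 0 m (segment x k) = segment x m :=
  subsegment_segment x ((zero_add m).trans_le h)

theorem primrec_subsegment :
    Primrec fun q : ℕ × ℕ × List (Fin D) => subsegment q.1 q.2.1 q.2.2 := by
  have hm : Primrec fun q : ℕ × ℕ × List (Fin D) => q.2.1 := Primrec.fst.comp Primrec.snd
  have hu : Primrec fun q : ℕ × ℕ × List (Fin D) => q.2.2 := Primrec.snd.comp Primrec.snd
  have hhalf := Primrec.nat_div.comp (Primrec.list_length.comp hu) (Primrec.const 2)
  exact Primrec.list_take.comp (Primrec.succ.comp (Primrec.nat_mul.comp (Primrec.const 2) hm))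
    (Primrec.list_drop.comp (Primrec.nat_sub.comp (Primrec.nat_add.comp hhalf Primrec.fst) hm) hu)

end Block

/-! ### Enumerability with an oracle -/

/-- The state `b` can be reached from a state that satisfies `A` by exactly `m` steps of the
relation `F`. -/
def ReachedIn {α : Type*} (A : α → Prop) (F : α × α → Prop) : ℕ → α → Prop
  | 0, b => A b
  | m + 1, b => ∃ a, ReachedIn A F m a ∧ F (a, b)

theorem reachedIn_iff_exists_list {α : Type*} {A : α → Prop} {F : α × α → Prop} {m : ℕ} {b : α} :
    ReachedIn A F m b ↔ ∃ L : List (ℕ × α), (m, b) ∈ L ∧ ∀ p ∈ L, (p.1 = 0 ∧ A p.2) ∨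
      ∃ p' : ℕ × α, (p.1 = p'.1 + 1 ∧ p' ∈ L) ∧ F (p'.2, p.2) := by
  constructor
  · intro h
    induction m generalizing b with
    | zero => exact ⟨[(0, b)], by simp, List.forall_mem_singleton.2 (.inl ⟨rfl, h⟩)⟩
    | succ m ih =>
      obtain ⟨a, ha, hab⟩ := h
      obtain ⟨L, haL, hL⟩ := ih ha
      refine ⟨(m + 1, b) :: L, List.mem_cons_self, List.forall_mem_cons.2
        ⟨.inr ⟨(m, a), ⟨rfl, List.mem_cons_of_mem _ haL⟩, hab⟩, fun p hp => ?_⟩⟩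
      exact (hL p hp).imp_right fun ⟨p', ⟨hp', hp'L⟩, h⟩ =>
        ⟨p', ⟨hp', List.mem_cons_of_mem _ hp'L⟩, h⟩
  · rintro ⟨L, hb, hL⟩
    induction m generalizing b with
    | zero =>
      rcases hL _ hb with ⟨-, h⟩ | ⟨p, ⟨h, -⟩, -⟩
      exacts [h, absurd h (Nat.succ_ne_zero _).symm]
    | succ m ih =>
      rcases hL _ hb with ⟨h, -⟩ | ⟨⟨i, a⟩, ⟨h, ha⟩, hab⟩
      · exact absurd h (Nat.succ_ne_zero m)
      · obtain rfl : m = i := Nat.succ_injective h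
        exact ⟨a, ih ha, hab⟩

section Enumerability

variable {α β : Type*} [Primcodable α] [Primcodable β] {s : BiSeq D}

theorem exists_primrecPred_of_rePred {p : α → Prop} (hp : REPred p) :
    ∃ B : α × ℕ → Prop, PrimrecPred B ∧ ∀ a, p a ↔ ∃ n, B (a, n) := by
  obtain ⟨c, hc⟩ := Nat.Partrec.Code.exists_code.1 hp
  have hdom (a : α) : p a ↔ (Nat.Partrec.Code.eval c (Encodable.encode a)).Dom := by
    simp [hc, Part.assert]
  refine ⟨fun q => (Nat.Partrec.Code.evaln q.2 c (Encodable.encode q.1)).isSome = true, ?_, ?_⟩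
  · exact Primrec.eq.comp (Primrec.option_isSome.comp (Nat.Partrec.Code.primrec_evaln.comp
      ((Primrec.snd.pair (Primrec.const c)).pair (Primrec.encode.comp Primrec.fst))))
      (Primrec.const true)
  · intro a
    simp only [hdom, Part.dom_iff_mem, Nat.Partrec.Code.evaln_complete, Option.isSome_iff_exists,
      Option.mem_def]
    exact exists_comm

namespace CEIn

variable {A A' : α → Prop}

theorem of_iff (hA : CEIn s A) (h : ∀ a, A a ↔ A' a) : CEIn s A' := by
  obtain ⟨W, hW, hAW⟩ := hA
  exact ⟨W, hW, fun a => (h a).symm.trans (hAW a)⟩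

theorem exists_segment {B : α × List (Fin D) → Prop} (hB : PrimrecPred B) :
    CEIn s fun a => ∃ k, B (a, segment s k) :=
  ⟨fun q => B (q.2, q.1), (hB.comp (Primrec.snd.pair Primrec.fst)).computablePred.to_re,
    fun _ => Iff.rfl⟩

theorem exists_primrecPred_mono (hA : CEIn s A) :
    ∃ B : α × List (Fin D) → Prop, PrimrecPred B ∧
      (∀ a, Monotone fun k => B (a, segment s k)) ∧
      ∀ a, A a ↔ ∃ k, B (a, segment s k) := by
  obtain ⟨W, hW, hAW⟩ := hA
  obtain ⟨b, hb, hWb⟩ := exists_primrecPred_of_rePred hW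
  -- The number `p` codes a pair `(m, n)`: the segment of radius `m` is enumerated at stage `n`.
  let R (p : ℕ) (q : α × List (Fin D)) : Prop :=
    b ((subsegment 0 p.unpair.1 q.2, q.1), p.unpair.2)
  have hR : PrimrecRel R := by
    have hp : Primrec fun z : ℕ × α × List (Fin D) => z.1.unpair := Primrec.unpair.comp Primrec.fst
    exact hb.comp (((primrec_subsegment.comp ((Primrec.const 0).pair ((Primrec.fst.comp hp).pair
      (Primrec.snd.comp Primrec.snd)))).pair (Primrec.fst.comp Primrec.snd)).pair
      (Primrec.snd.comp hp))
  have hRs (a : α) {k p : ℕ} (h : p ≤ k) :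
      R p (a, segment s k) ↔ b ((segment s p.unpair.1, a), p.unpair.2) := by
    simp only [R, subsegment_zero_segment s (p.unpair_left_le.trans h)]
  refine ⟨fun q => ∃ p ∈ List.range (q.2.length / 2 + 1), R p q, ?_, fun a k k' hk => ?_,
    fun a => ?_⟩
  · exact hR.exists_mem_list.comp (Primrec.list_range.comp (Primrec.succ.comp
      (Primrec.nat_div.comp (Primrec.list_length.comp Primrec.snd) (Primrec.const 2)))) Primrec.id
  · simp only [half_length_segment, List.mem_range, Nat.lt_succ_iff]
    rintro ⟨p, hp, h⟩
    exact ⟨p, hp.trans hk, (hRs a (hp.trans hk)).2 ((hRs a hp).1 h)⟩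
  · have hA' : A a ↔ ∃ m n, b ((segment s m, a), n) := by
      simp only [hAW, OracleEnum, hWb, segment]
    simp only [hA', half_length_segment, List.mem_range, Nat.lt_succ_iff]
    constructor
    · rintro ⟨m, n, h⟩
      exact ⟨Nat.pair m n, _, le_rfl, (hRs a le_rfl).2 (by simpa using h)⟩
    · rintro ⟨k, p, hp, h⟩
      exact ⟨_, _, (hRs a hp).1 h⟩

theorem of_primrecPred (hA : PrimrecPred A) : CEIn s A :=
  (exists_segment (hA.comp Primrec.fst)).of_iff fun a => by simp

theorem comp {A : β → Prop} (hA : CEIn s A) {f : α → β} (hf : Computable f) :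
    CEIn s fun a => A (f a) := by
  obtain ⟨W, hW, hAW⟩ := hA
  have hWf : REPred fun q : List (Fin D) × α => W (q.1, f q.2) :=
    Partrec.comp hW (Computable.fst.pair (hf.comp Computable.snd))
  exact ⟨_, hWf, fun a => hAW (f a)⟩

theorem and (hA : CEIn s A) (hA' : CEIn s A') : CEIn s fun a => A a ∧ A' a := by
  obtain ⟨B, hB, hmono, h⟩ := hA.exists_primrecPred_mono
  obtain ⟨B', hB', hmono', h'⟩ := hA'.exists_primrecPred_mono
  refine (exists_segment (hB.and hB')).of_iff fun a => ?_
  rw [h, h']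
  constructor
  · rintro ⟨k, hk, hk'⟩
    exact ⟨⟨k, hk⟩, ⟨k, hk'⟩⟩
  · rintro ⟨⟨k, hk⟩, ⟨k', hk'⟩⟩
    exact ⟨max k k', hmono a (le_max_left k k') hk, hmono' a (le_max_right k k') hk'⟩

theorem or (hA : CEIn s A) (hA' : CEIn s A') : CEIn s fun a => A a ∨ A' a := by
  obtain ⟨B, hB, -, h⟩ := hA.exists_primrecPred_mono
  obtain ⟨B', hB', -, h'⟩ := hA'.exists_primrecPred_mono
  refine (exists_segment (hB.or hB')).of_iff fun a => ?_
  rw [h, h', exists_or]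

theorem ex {A : α × β → Prop} (hA : CEIn s A) : CEIn s fun a => ∃ b, A (a, b) := by
  obtain ⟨B, hB, hmono, h⟩ := hA.exists_primrecPred_mono
  let candidates (u : List (Fin D)) : List β := (List.range u.length).filterMap Encodable.decode
  have hcandidates : Primrec candidates :=
    Primrec.listFilterMap (Primrec.list_range.comp Primrec.list_length)
      (Primrec.decode.comp Primrec.snd)
  have mem_candidates (b : β) {u : List (Fin D)} (hu : Encodable.encode b < u.length) :
      b ∈ candidates u :=
    List.mem_filterMap.2 ⟨_, List.mem_range.2 hu, Encodable.encodek b⟩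
  have hrel : PrimrecRel fun (b : β) (q : α × List (Fin D)) => B ((q.1, b), q.2) :=
    hB.comp (((Primrec.fst.comp Primrec.snd).pair Primrec.fst).pair
      (Primrec.snd.comp Primrec.snd))
  refine (exists_segment (hrel.exists_mem_list.comp (hcandidates.comp Primrec.snd)
    Primrec.id)).of_iff fun a => ?_
  simp only [h]
  constructor
  · rintro ⟨k, b, -, hk⟩
    exact ⟨b, k, hk⟩
  · rintro ⟨b, k, hk⟩
    exact ⟨max k (Encodable.encode b), b, mem_candidates b (by simp; omega),
      hmono _ (le_max_left _ _) hk⟩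

theorem forall_mem {A : α × β → Prop} (hA : CEIn s A) :
    CEIn s fun q : α × List β => ∀ b ∈ q.2, A (q.1, b) := by
  obtain ⟨B, hB, hmono, h⟩ := hA.exists_primrecPred_mono
  have hrel : PrimrecRel fun (b : β) (q : α × List (Fin D)) => B ((q.1, b), q.2) :=
    hB.comp (((Primrec.fst.comp Primrec.snd).pair Primrec.fst).pair
      (Primrec.snd.comp Primrec.snd))
  refine (exists_segment (hrel.forall_mem_list.comp (Primrec.snd.comp Primrec.fst)
    ((Primrec.fst.comp Primrec.fst).pair Primrec.snd))).of_iff ?_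
  rintro ⟨a, l⟩
  simp only [h]
  constructor
  · rintro ⟨k, hk⟩ b hb
    exact ⟨k, hk b hb⟩
  · intro hl
    have hlarge : ∀ᶠ k in atTop, ∀ b ∈ {b | b ∈ l}, B ((a, b), segment s k) :=
      ((List.finite_toSet l).eventually_all).2 fun b hb =>
        (hl b hb).elim fun k hk => eventually_atTop.2 ⟨k, fun k' hk' => hmono _ hk' hk⟩
    exact hlarge.exists

theorem forall_lt {A : α × ℕ → Prop} (hA : CEIn s A) :
    CEIn s fun q : α × ℕ => ∀ i < q.2, A (q.1, i) :=
  (hA.forall_mem.comp (f := fun q : α × ℕ => (q.1, List.range q.2))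
    (Primrec.fst.pair (Primrec.list_range.comp Primrec.snd)).to_comp).of_iff fun q => by simp

theorem decide_segment {B : (α × ℕ) × List (Fin D) → Prop} (hB : PrimrecPred B) :
    CEIn s fun q : α × ℕ => B (q, segment s q.2) := by
  have hlength : PrimrecPred fun q : (α × ℕ) × List (Fin D) => q.2.length = 2 * q.1.2 + 1 :=
    Primrec.eq.comp (Primrec.list_length.comp Primrec.snd) (Primrec.succ.comp
      (Primrec.nat_mul.comp (Primrec.const 2) (Primrec.snd.comp Primrec.fst)))
  refine (exists_segment (hlength.and hB)).of_iff fun q => ?_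
  constructor
  · rintro ⟨k, hk, h⟩
    obtain rfl : k = q.2 := by simpa using hk
    exact h
  · exact fun h => ⟨q.2, length_segment s q.2, h⟩

/-- Dovetailing: an enumeration can be arranged in stages that the oracle decides. -/
theorem exists_stage (hA : CEIn s A) :
    ∃ S : α × ℕ → Prop, CEIn s S ∧ CEIn s (fun q => ¬ S q) ∧ ∀ a, A a ↔ ∃ t, S (a, t) := by
  obtain ⟨B, hB, -, h⟩ := hA.exists_primrecPred_mono
  have hB' : PrimrecPred fun q : (α × ℕ) × List (Fin D) => B (q.1.1, q.2) :=
    hB.comp ((Primrec.fst.comp Primrec.fst).pair Primrec.snd)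
  exact ⟨_, decide_segment hB', decide_segment hB'.not, h⟩

theorem exists_uniformization {R : α × ℕ → Prop} (hR : CEIn s R) :
    ∃ F : α × ℕ → Prop, CEIn s F ∧ (∀ q, F q → R q) ∧
      (∀ a m n, F (a, m) → F (a, n) → m = n) ∧ ∀ a, (∃ n, R (a, n)) → ∃ n, F (a, n) := by
  obtain ⟨S, hS, hS', h⟩ := hR.exists_stage
  let g : α × ℕ → (α × ℕ) × ℕ := fun q => ((q.1, q.2.unpair.1), q.2.unpair.2)
  have hg : Computable g := by
    have hu : Primrec fun z : α × ℕ => z.2.unpair := Primrec.unpair.comp Primrec.snd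
    exact ((Primrec.fst.pair (Primrec.fst.comp hu)).pair (Primrec.snd.comp hu)).to_comp
  have hneg : CEIn s fun q : α × ℕ => ∀ i < q.2, ¬ S (g (q.1, i)) :=
    CEIn.forall_lt (A := fun q => ¬ S (g q)) (hS'.comp hg)
  let F : α × ℕ → Prop := fun q => ∃ t : ℕ,
    (S (g (q.1, t)) ∧ (∀ i < t, ¬ S (g (q.1, i)))) ∧ q.2 = t.unpair.1
  refine ⟨F, ?_, ?_, ?_, ?_⟩
  · refine CEIn.ex (A := fun z : (α × ℕ) × ℕ => (S (g (z.1.1, z.2)) ∧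
      (∀ i < z.2, ¬ S (g (z.1.1, i)))) ∧ z.1.2 = z.2.unpair.1) (.and (.and ?_ ?_) ?_)
    · exact hS.comp (hg.comp ((Computable.fst.comp Computable.fst).pair Computable.snd))
    · exact hneg.comp (f := fun z : (α × ℕ) × ℕ => (z.1.1, z.2))
        ((Computable.fst.comp Computable.fst).pair Computable.snd)
    · exact .of_primrecPred (Primrec.eq.comp (Primrec.snd.comp Primrec.fst)
        (Primrec.fst.comp (Primrec.unpair.comp Primrec.snd)))
  · rintro ⟨a, n⟩ ⟨t, ⟨ht, -⟩, rfl⟩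
    exact (h _).2 ⟨_, ht⟩
  · rintro a m n ⟨t, ⟨ht, ht'⟩, rfl⟩ ⟨t', ⟨hs, hs'⟩, rfl⟩
    rcases lt_trichotomy t t' with hlt | rfl | hlt
    · exact absurd ht (hs' t hlt)
    · rfl
    · exact absurd hs (ht' t' hlt)
  · rintro a ⟨n, hn⟩
    obtain ⟨t, ht⟩ := (h _).1 hn
    classical
    have hex : ∃ t, S (g (a, t)) := ⟨Nat.pair n t, by simpa [g] using ht⟩
    exact ⟨_, Nat.find hex, ⟨Nat.find_spec hex, fun i hi => Nat.find_min hex hi⟩, rfl⟩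

theorem reachedIn {F : α × α → Prop} (hA : CEIn s A) (hF : CEIn s F) :
    CEIn s fun q : ℕ × α => ReachedIn A F q.1 q.2 := by
  have hmem : PrimrecPred fun z : List (ℕ × α) × (ℕ × α) => z.2 ∈ z.1 :=
    (Primrec.eq.exists_mem_list.comp Primrec.fst Primrec.snd).of_eq fun z => by simp
  have hstart : CEIn s fun z : List (ℕ × α) × (ℕ × α) => z.2.1 = 0 ∧ A z.2.2 :=
    .and (.of_primrecPred (Primrec.eq.comp (Primrec.fst.comp Primrec.snd) (Primrec.const 0)))
      (hA.comp (Primrec.snd.comp Primrec.snd).to_comp)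
  have hstep : CEIn s fun z : (List (ℕ × α) × (ℕ × α)) × (ℕ × α) =>
      (z.1.2.1 = z.2.1 + 1 ∧ z.2 ∈ z.1.1) ∧ F (z.2.2, z.1.2.2) :=
    .and (.of_primrecPred ((Primrec.eq.comp (Primrec.fst.comp (Primrec.snd.comp Primrec.fst))
        (Primrec.succ.comp (Primrec.fst.comp Primrec.snd))).and
        (hmem.comp ((Primrec.fst.comp Primrec.fst).pair Primrec.snd))))
      (hF.comp ((Primrec.snd.comp Primrec.snd).pair
        (Primrec.snd.comp (Primrec.snd.comp Primrec.fst))).to_comp)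
  have hcertificate := (CEIn.of_primrecPred (s := s)
    (hmem.comp (Primrec.snd.pair Primrec.fst))).and ((hstart.or hstep.ex).forall_mem.comp
      (Primrec.snd.pair (Primrec.snd (α := ℕ × α) (β := List (ℕ × α)))).to_comp)
  exact hcertificate.ex.of_iff fun _ => reachedIn_iff_exists_list.symm

end CEIn

end Enumerability

section BlockProbability

variable (P : ProbabilityMeasure (BiSeq D)) (j : ℤ)

theorem blockProb_nonneg (w : List (Fin D)) : 0 ≤ blockProb P j w := measureReal_nonneg

@[simp] theorem blockProb_nil : blockProb P j [] = 1 := by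
  simp [blockProb, block]

theorem cylinder_nil_left (w : List (Fin D)) : cylinder [] w = {x | block x 1 w.length = w} := by
  simp [cylinder]

end BlockProbability

section Comparison

variable {γ : Type*} {μ : γ → ℝ}

theorem sum_map_lt_of_ratOfCode {c : ℕ} {u v : List (γ × ℕ)}
    (hu : ∀ p ∈ u, μ p.1 < ratOfCode (p.2, 0, c)) (hv : ∀ p ∈ v, ratOfCode (p.2, 1, c) < μ p.1)
    (huv : (u.map Prod.snd).sum + v.length < (v.map Prod.snd).sum) :
    ((u.map Prod.fst).map μ).sum < ((v.map Prod.fst).map μ).sum := by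
  have hc : (0 : ℝ) < c + 1 := by positivity
  have hu' : ((u.map Prod.fst).map μ).sum * (c + 1) ≤ (u.map Prod.snd).sum := by
    rw [List.map_map, ← List.sum_map_mul_right, ← Nat.coe_castRingHom, map_list_sum, List.map_map]
    refine List.sum_le_sum fun p hp => ?_
    have h := hu p hp
    simp only [ratOfCode] at h
    push_cast at h
    rw [sub_zero, lt_div_iff₀ hc] at h
    exact h.le
  have hv' : ((v.map Prod.snd).sum : ℝ) ≤ ((v.map Prod.fst).map μ).sum * (c + 1) + v.length := by
    have hlen : (v.length : ℝ) = (v.map fun _ => (1 : ℝ)).sum := by simp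
    rw [hlen, List.map_map, ← List.sum_map_mul_right, ← List.sum_map_add, ← Nat.coe_castRingHom,
      map_list_sum, List.map_map]
    refine List.sum_le_sum fun p hp => ?_
    have h := hv p hp
    simp only [ratOfCode] at h
    push_cast at h
    rw [div_lt_iff₀ hc] at h
    simpa using (sub_lt_iff_lt_add.1 h).le
  have huv' : ((u.map Prod.snd).sum + v.length : ℝ) < (v.map Prod.snd).sum := by exact_mod_cast huv
  exact lt_of_mul_lt_mul_right (by linarith) hc.le

theorem exists_ratOfCode_of_sum_map_lt (hμ : ∀ a, 0 ≤ μ a) {l l' : List γ}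
    (h : (l.map μ).sum < (l'.map μ).sum) :
    ∃ (c : ℕ) (u v : List (γ × ℕ)), u.map Prod.fst = l ∧ v.map Prod.fst = l' ∧
      (∀ p ∈ u, μ p.1 < ratOfCode (p.2, 0, c)) ∧ (∀ p ∈ v, ratOfCode (p.2, 1, c) < μ p.1) ∧
      (u.map Prod.snd).sum + v.length < (v.map Prod.snd).sum := by
  obtain ⟨c, hc⟩ := exists_nat_gt
    ((l.length + l'.length) / ((l'.map μ).sum - (l.map μ).sum) : ℝ)
  rw [div_lt_iff₀ (sub_pos.2 h)] at hc
  have hc0 : (0 : ℝ) < c + 1 := by positivity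
  have hnonneg (a : γ) : 0 ≤ μ a * (c + 1) := mul_nonneg (hμ a) hc0.le
  refine ⟨c, l.map fun a => (a, ⌊μ a * (c + 1)⌋₊ + 1), l'.map fun a => (a, ⌈μ a * (c + 1)⌉₊),
    by simp [Function.comp_def], by simp [Function.comp_def], ?_, ?_, ?_⟩
  · simp only [List.forall_mem_map, ratOfCode]
    intro a _
    push_cast
    rw [sub_zero, lt_div_iff₀ hc0]
    exact Nat.lt_floor_add_one _
  · simp only [List.forall_mem_map, ratOfCode]
    intro a _
    push_cast
    rw [div_lt_iff₀ hc0, sub_lt_iff_lt_add]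
    exact Nat.ceil_lt_add_one (hnonneg a)
  · have hl : (((l.map fun a => ⌊μ a * (c + 1)⌋₊ + 1).sum : ℕ) : ℝ)
        ≤ (l.map μ).sum * (c + 1) + l.length := by
      have hlen : (l.length : ℝ) = (l.map fun _ => (1 : ℝ)).sum := by simp
      rw [hlen, ← List.sum_map_mul_right, ← List.sum_map_add, ← Nat.coe_castRingHom,
        map_list_sum, List.map_map]
      exact List.sum_le_sum fun a _ => by simpa using Nat.floor_le (hnonneg a)
    have hl' : (l'.map μ).sum * (c + 1) ≤ ((l'.map fun a => ⌈μ a * (c + 1)⌉₊).sum : ℕ) := by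
      rw [← List.sum_map_mul_right, ← Nat.coe_castRingHom, map_list_sum, List.map_map]
      exact List.sum_le_sum fun a _ => Nat.le_ceil _
    simp only [List.map_map, Function.comp_def, List.length_map]
    rw [← Nat.cast_lt (α := ℝ), Nat.cast_add]
    linarith

theorem primrec_list_sum_nat : Primrec (List.sum : List ℕ → ℕ) :=
  Primrec.list_foldr Primrec.id (Primrec.const 0)
    (Primrec.nat_add.comp (Primrec.fst.comp Primrec.snd) (Primrec.snd.comp Primrec.snd)).to₂

variable {α : Type*} [Primcodable α] {s : BiSeq D} {P : ProbabilityMeasure (BiSeq D)}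

theorem IsRepresentation.ceIn_blockProb_lt (hs : IsRepresentation s P) :
    CEIn s fun q : List (Fin D) × (ℕ × ℕ × ℕ) => blockProb P 1 q.1 < ratOfCode q.2 := by
  obtain ⟨ρ, ⟨-, W, hW, h⟩, rfl⟩ := hs
  have hcylinder : CEIn s fun p : (List (Fin D) × List (Fin D)) × (ℕ × ℕ × ℕ) =>
    (ρ s : Measure (BiSeq D)).real (cylinder p.1.1 p.1.2) < (ratOfCode p.2 : ℝ) := ⟨W, hW, h s⟩
  exact (hcylinder.comp (f := fun q : List (Fin D) × (ℕ × ℕ × ℕ) => (([], q.1), q.2))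
    (((Primrec.const []).pair Primrec.fst).pair Primrec.snd).to_comp).of_iff fun q => by
      rw [cylinder_nil_left, blockProb]

theorem IsRepresentation.ceIn_lt_blockProb (hs : IsRepresentation s P) :
    CEIn s fun q : List (Fin D) × (ℕ × ℕ × ℕ) => ratOfCode q.2 < blockProb P 1 q.1 := by
  obtain ⟨ρ, ⟨⟨W, hW, h⟩, -⟩, rfl⟩ := hs
  have hcylinder : CEIn s fun p : (List (Fin D) × List (Fin D)) × (ℕ × ℕ × ℕ) =>
    (ratOfCode p.2 : ℝ) < (ρ s : Measure (BiSeq D)).real (cylinder p.1.1 p.1.2) := ⟨W, hW, h s⟩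
  exact (hcylinder.comp (f := fun q : List (Fin D) × (ℕ × ℕ × ℕ) => (([], q.1), q.2))
    (((Primrec.const []).pair Primrec.fst).pair Primrec.snd).to_comp).of_iff fun q => by
      rw [cylinder_nil_left, blockProb]

theorem IsRepresentation.ceIn_sum_blockProb_lt (hs : IsRepresentation s P)
    {L L' : α → List (List (Fin D))} (hL : Computable L) (hL' : Computable L') :
    CEIn s fun a => ((L a).map (blockProb P 1)).sum < ((L' a).map (blockProb P 1)).sum := by
  let Words := List (List (Fin D))
  let Approx := List (List (Fin D) × ℕ)
  have hfst : Primrec fun u : Approx => u.map Prod.fst :=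
    Primrec.list_map Primrec.id (Primrec.fst.comp Primrec.snd).to₂
  have hsum : Primrec fun u : Approx => (u.map Prod.snd).sum :=
    primrec_list_sum_nat.comp (Primrec.list_map Primrec.id (Primrec.snd.comp Primrec.snd).to₂)
  have hc : Primrec fun q : (Words × Words) × ℕ × Approx × Approx => q.2.1 :=
    Primrec.fst.comp Primrec.snd
  have hu : Primrec fun q : (Words × Words) × ℕ × Approx × Approx => q.2.2.1 :=
    Primrec.fst.comp (Primrec.snd.comp Primrec.snd)
  have hv : Primrec fun q : (Words × Words) × ℕ × Approx × Approx => q.2.2.2 :=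
    Primrec.snd.comp (Primrec.snd.comp Primrec.snd)
  have hcode (b : ℕ) : Primrec fun z : ℕ × List (Fin D) × ℕ => (z.2.1, z.2.2, b, z.1) :=
    (Primrec.fst.comp Primrec.snd).pair
      ((Primrec.snd.comp Primrec.snd).pair ((Primrec.const b).pair Primrec.fst))
  have hbelow := (hs.ceIn_blockProb_lt.comp (hcode 0).to_comp).forall_mem.comp (hc.pair hu).to_comp
  have habove := (hs.ceIn_lt_blockProb.comp (hcode 1).to_comp).forall_mem.comp (hc.pair hv).to_comp
  have hdecidable := (((Primrec.eq.comp (hfst.comp hu) (Primrec.fst.comp Primrec.fst)).and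
    (Primrec.eq.comp (hfst.comp hv) (Primrec.snd.comp Primrec.fst))).and
    (Primrec.nat_lt.comp (Primrec.nat_add.comp (hsum.comp hu) (Primrec.list_length.comp hv))
      (hsum.comp hv)))
  refine (((CEIn.of_primrecPred hdecidable).and (hbelow.and habove)).ex.comp
    (hL.pair hL')).of_iff fun a => ?_
  constructor
  · rintro ⟨⟨c, u, v⟩, ⟨⟨hfst, hfst'⟩, huv⟩, hu, hv⟩
    have hlt := sum_map_lt_of_ratOfCode hu hv huv
    simp only [hfst, hfst'] at hlt
    exact hlt
  · intro h
    obtain ⟨c, u, v, hfst, hfst', hu, hv, huv⟩ :=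
      exists_ratOfCode_of_sum_map_lt (blockProb_nonneg P 1) h
    exact ⟨⟨c, u, v⟩, ⟨⟨hfst, hfst'⟩, huv⟩, hu, hv⟩

theorem IsRepresentation.ceIn_mul_sum_blockProb_lt (hs : IsRepresentation s P) {m m' : α → ℕ}
    {L L' : α → List (List (Fin D))} (hm : Computable m) (hL : Computable L) (hm' : Computable m')
    (hL' : Computable L') :
    CEIn s fun a => m a * ((L a).map (blockProb P 1)).sum <
      m' a * ((L' a).map (blockProb P 1)).sum := by
  let repeated (p : ℕ × List (List (Fin D))) : List (List (Fin D)) :=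
    (List.range p.1).flatMap fun _ => p.2
  have hrepeated : Computable repeated :=
    (Primrec.list_flatMap (Primrec.list_range.comp Primrec.fst)
      (Primrec.snd.comp Primrec.fst).to₂).to_comp
  have hsum (p : ℕ × List (List (Fin D))) :
      ((repeated p).map (blockProb P 1)).sum = p.1 * (p.2.map (blockProb P 1)).sum := by
    simp [repeated, List.flatMap_def]
  exact (hs.ceIn_sum_blockProb_lt (hrepeated.comp (hm.pair hL))
    (hrepeated.comp (hm'.pair hL'))).of_iff fun a => by rw [hsum, hsum]

end Comparison

/-! ### Open sets, stationarity and tests -/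

section OpenSets

theorem measurableSet_block_mem (j : ℤ) (n : ℕ) (A : Set (List (Fin D))) :
    MeasurableSet {x : BiSeq D | block x j n ∈ A} := by
  have hofFn (x : BiSeq D) : block x j n = List.ofFn fun i : Fin n => x (j + (i : ℤ)) := by
    rw [block_eq_map, ← List.map_coe_finRange_eq_range, List.map_map, List.ofFn_eq_map]
    rfl
  have hcoord : Measurable fun (x : BiSeq D) (i : Fin n) => x (j + (i : ℤ)) :=
    measurable_pi_lambda _ fun i => measurable_pi_apply _
  simp only [hofFn]
  exact hcoord (Set.toFinite {u | List.ofFn u ∈ A}).measurableSet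

theorem measurableSet_block_eq (j : ℤ) (n : ℕ) (w : List (Fin D)) :
    MeasurableSet {x : BiSeq D | block x j n = w} :=
  measurableSet_block_mem j n {w}

/-- The open set of all points that have a central segment in `V`. -/
def openSet (V : List (Fin D) → Prop) : Set (BiSeq D) := {x | ∃ k, V (segment x k)}

theorem measurableSet_openSet (V : List (Fin D) → Prop) : MeasurableSet (openSet V) := by
  simp only [openSet, Set.ofPred_exists]
  exact MeasurableSet.iUnion fun k => measurableSet_block_mem _ _ {v | V v}

theorem measurableSet_segment_eq (k : ℕ) (w : List (Fin D)) :
    MeasurableSet {x : BiSeq D | segment x k = w} :=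
  measurableSet_block_eq _ _ w

variable {P : ProbabilityMeasure (BiSeq D)}

theorem measureReal_block_eq (hP : MeasurePreserving shift (P : Measure (BiSeq D)) P) (j : ℤ)
    {n : ℕ} {w : List (Fin D)} (hw : w.length = n) :
    (P : Measure (BiSeq D)).real {x | block x j n = w} = blockProb P 1 w := by
  subst hw
  have hadd (j : ℤ) (m : ℕ) : blockProb P (j + m) w = blockProb P j w := by
    rw [blockProb, blockProb,
      ← (hP.iterate m).measureReal_preimage (measurableSet_block_eq j _ w).nullMeasurableSet]
    simp only [Set.preimage_ofPred_eq, block_iterate_shift]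
  change blockProb P j w = blockProb P 1 w
  rcases le_total j 1 with hj | hj
  · obtain ⟨m, hm⟩ := Int.le.dest hj
    rw [← hm, hadd]
  · obtain ⟨m, rfl⟩ := Int.le.dest hj
    exact hadd 1 m

end OpenSets

section Tests

variable {s x : BiSeq D} {P : ProbabilityMeasure (BiSeq D)}

theorem exists_mem_cylinder_segment (V : List (Fin D) → Prop) (x : BiSeq D) :
    (∃ p : List (Fin D) × List (Fin D), (p.1.length = p.2.length + 1 ∧ V (p.1 ++ p.2)) ∧
      x ∈ cylinder p.1 p.2) ↔ x ∈ openSet V := by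
  constructor
  · rintro ⟨⟨σ, τ⟩, ⟨hlen, hV⟩, hx⟩
    dsimp only at hlen hV hx
    refine ⟨τ.length, ?_⟩
    have hx' : segment x τ.length = σ ++ τ := by
      rw [← hx, segment, hlen]
      congr 1 <;> push_cast <;> ring
    rwa [hx']
  · rintro ⟨k, hk⟩
    refine ⟨((segment x k).take (k + 1), (segment x k).drop (k + 1)),
      ⟨by simp; omega, by rwa [List.take_append_drop]⟩, ?_⟩
    simp only [cylinder, Set.mem_ofPred_eq, List.take_append_drop]
    rw [List.length_take, List.length_drop, length_segment, segment]
    congr 1 <;> omega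

theorem IsOneRandomWith.exists_notMem_of_le_geometric (hx : IsOneRandomWith s P x)
    {V : ℕ × List (Fin D) → Prop} (hV : CEIn s V) {C r : ℝ} (hr0 : 0 ≤ r) (hr : r < 1)
    (hbound : ∀ m, (P : Measure (BiSeq D)).real (openSet fun u => V (m, u)) ≤ C * r ^ m) :
    ∃ m, x ∉ openSet fun u => V (m, u) := by
  obtain ⟨c, hc⟩ := exists_pow_lt_of_lt_one (show (0 : ℝ) < 2⁻¹ by norm_num) hr
  obtain ⟨d, hd⟩ : ∃ d : ℕ, C * r ^ d ≤ 1 := by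
    have h := (tendsto_pow_atTop_nhds_zero_of_lt_one hr0 hr).const_mul C
    rw [mul_zero] at h
    exact (h.eventually (eventually_le_nhds zero_lt_one)).exists
  have hlevel : Primrec fun q : ℕ × (List (Fin D) × List (Fin D)) =>
      (c * q.1 + d, q.2.1 ++ q.2.2) :=
    (Primrec.nat_add.comp (Primrec.nat_mul.comp (Primrec.const c) Primrec.fst)
      (Primrec.const d)).pair (Primrec.list_append.comp (Primrec.fst.comp Primrec.snd)
        (Primrec.snd.comp Primrec.snd))
  have hlength : PrimrecPred fun q : ℕ × (List (Fin D) × List (Fin D)) =>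
      q.2.1.length = q.2.2.length + 1 :=
    Primrec.eq.comp (Primrec.list_length.comp (Primrec.fst.comp Primrec.snd))
      (Primrec.succ.comp (Primrec.list_length.comp (Primrec.snd.comp Primrec.snd)))
  have htest : IsMartinLofTest s P fun k => openSet fun u => V (c * k + d, u) := by
    refine ⟨⟨_, fun k _ => Set.ext fun y => (exists_mem_cylinder_segment _ y).symm,
      (CEIn.of_primrecPred hlength).and (hV.comp hlevel.to_comp)⟩, fun k _ => ?_⟩
    calc (P : Measure (BiSeq D)).real (openSet fun u => V (c * k + d, u))
        ≤ (r ^ c) ^ k * (C * r ^ d) := (hbound _).trans_eq (by rw [pow_add, pow_mul]; ring)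
      _ ≤ (r ^ c) ^ k := mul_le_of_le_one_right (by positivity) hd
      _ ≤ 2⁻¹ ^ k := pow_le_pow_left₀ (by positivity) hc.le k
  by_contra! h
  exact hx _ htest fun i _ => h (c * i + d)

theorem IsOneRandomWith.measureReal_segment_eq_pos (hx : IsOneRandomWith s P x) (k : ℕ) :
    0 < (P : Measure (BiSeq D)).real {y | segment y k = segment x k} := by
  refine measureReal_nonneg.lt_of_ne' fun hzero => ?_
  have hV : CEIn s fun q : ℕ × List (Fin D) => q.2 = segment x k :=
    .of_primrecPred (Primrec.eq.comp Primrec.snd (Primrec.const _))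
  have hopen : openSet (fun u => u = segment x k) = {y | segment y k = segment x k} := by
    ext y
    refine ⟨fun ⟨k', hk'⟩ => ?_, fun hy => ⟨k, hy⟩⟩
    obtain rfl : k' = k := by simpa using congrArg List.length hk'
    exact hk'
  obtain ⟨m, hm⟩ := hx.exists_notMem_of_le_geometric hV (C := 0) (r := 0) le_rfl one_pos
    fun m => by simp [hopen, hzero]
  exact hm ⟨k, rfl⟩

theorem IsOneRandomWith.blockProb_pos (hx : IsOneRandomWith s P x) (n : ℕ) :
    0 < blockProb P 1 (block x 1 n) := by
  refine (hx.measureReal_segment_eq_pos n).trans_le (measureReal_mono fun y hy => ?_)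
  have hsub (z : BiSeq D) : ((segment z n).drop (n + 1)).take n = block z 1 n := by
    rw [segment, take_drop_block z _ (by omega)]
    congr 1
    push_cast
    ring
  simp only [Set.mem_ofPred_eq, length_block] at hy ⊢
  rw [← hsub, hy, hsub]

end Tests

/-! ### Ergodic theory -/

section MeanErgodic

variable {Ω : Type*} [MeasurableSpace Ω] {μ : Measure Ω} {T : Ω → Ω}

open scoped InnerProductSpace

theorem integral_comp_of_measurePreserving (hT : MeasurePreserving T μ μ) {g : Ω → ℝ}
    (hg : AEStronglyMeasurable g μ) : ∫ y, g (T y) ∂μ = ∫ y, g y ∂μ := by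
  rw [← integral_map hT.measurable.aemeasurable (hT.map_eq.symm ▸ hg), hT.map_eq]

/-- The second moment of the number of visits to `C` at the times `0, ..., n - 1`. -/
noncomputable def visitCorr (μ : Measure Ω) (T : Ω → Ω) (C : Set Ω) (n : ℕ) : ℝ :=
  ∑ i ∈ Finset.range n, ∑ j ∈ Finset.range n, μ.real (T^[i] ⁻¹' C ∩ T^[j] ⁻¹' C)

theorem visitCorr_preimage_iterate (hT : MeasurePreserving T μ μ) {C : Set Ω}
    (hC : MeasurableSet C) (m n : ℕ) : visitCorr μ T (T^[m] ⁻¹' C) n = visitCorr μ T C n := by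
  have hmeas (i : ℕ) : MeasurableSet (T^[i] ⁻¹' C) := hC.preimage (hT.iterate i).measurable
  refine Finset.sum_congr rfl fun i _ => Finset.sum_congr rfl fun j _ => ?_
  rw [← (hT.iterate m).measureReal_preimage ((hmeas i).inter (hmeas j)).nullMeasurableSet,
    Set.preimage_inter]
  simp only [← Set.preimage_comp, ← Function.iterate_add, add_comm]

variable [IsProbabilityMeasure μ]

theorem inner_const_one (f : Lp ℝ 2 μ) : ⟪Lp.const 2 μ (1 : ℝ), f⟫_ℝ = ∫ y, f y ∂μ := by
  rw [← indicatorConstLp_univ, L2.inner_indicatorConstLp_one, setIntegral_univ]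

theorem inner_const_one_birkhoffAverage (hT : MeasurePreserving T μ μ) (f : Lp ℝ 2 μ) {n : ℕ}
    (hn : n ≠ 0) : ⟪Lp.const 2 μ (1 : ℝ), birkhoffAverage ℝ (Lp.compMeasurePreserving T hT)
      _root_.id n f⟫_ℝ = ∫ y, f y ∂μ := by
  have hiterate (i : ℕ) : ∫ y, (Lp.compMeasurePreserving T hT)^[i] f y ∂μ = ∫ y, f y ∂μ := by
    rw [Lp.compMeasurePreserving_iterate,
      integral_congr_ae (Lp.coeFn_compMeasurePreserving f (hT.iterate i))]
    exact integral_comp_of_measurePreserving (hT.iterate i) (Lp.aestronglyMeasurable f)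
  simp only [birkhoffAverage, birkhoffSum, inner_smul_right, inner_sum, inner_const_one, id,
    hiterate, Finset.sum_const, Finset.card_range, nsmul_eq_mul]
  exact inv_mul_cancel_left₀ (Nat.cast_ne_zero.2 hn) _

theorem tendsto_birkhoffAverage_compMeasurePreserving (hT : Ergodic T μ) (f : Lp ℝ 2 μ) :
    Tendsto (fun n => birkhoffAverage ℝ (Lp.compMeasurePreserving T hT.toMeasurePreserving)
      _root_.id n f) atTop (𝓝 (Lp.const 2 μ (∫ y, f y ∂μ))) := by
  have hmp := hT.toMeasurePreserving
  let U : Lp ℝ 2 μ →L[ℝ] Lp ℝ 2 μ := (Lp.compMeasurePreservingₗᵢ ℝ T hmp).toContinuousLinearMap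
  have hlim := U.tendsto_birkhoffAverage_orthogonalProjection
    (LinearIsometry.norm_toContinuousLinearMap_le _) f
  let p := (U.eqLocus (1 : Lp ℝ 2 μ →L[ℝ] Lp ℝ 2 μ)).orthogonalProjectionOnto f
  have hinvariant : Lp.compMeasurePreserving T hmp p = (p : Lp ℝ 2 μ) := p.2
  obtain ⟨c, hc⟩ : ∃ c, (p : Lp ℝ 2 μ) =ᵐ[μ] Function.const Ω c := by
    refine hT.ae_eq_const_of_ae_eq_comp_ae (Lp.aestronglyMeasurable _) ?_
    have h := Lp.coeFn_compMeasurePreserving (p : Lp ℝ 2 μ) hmp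
    rw [hinvariant] at h
    exact h.symm
  have hp : (p : Lp ℝ 2 μ) = Lp.const 2 μ c := Lp.ext (hc.trans (Lp.coeFn_const 2 μ c).symm)
  have hconst : c = ∫ y, f y ∂μ := by
    have hone : ⟪Lp.const 2 μ (1 : ℝ), (p : Lp ℝ 2 μ)⟫_ℝ = c := by
      rw [inner_const_one, integral_congr_ae hc]
      simp
    rw [← hone]
    refine tendsto_nhds_unique (tendsto_const_nhds.inner hlim) (tendsto_const_nhds.congr' ?_)
    filter_upwards [eventually_ne_atTop 0] with n hn
    exact (inner_const_one_birkhoffAverage hmp f hn).symm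
  rw [← hconst, ← hp]
  exact hlim

/-- The indicator function of `A` in `L²`. -/
noncomputable abbrev indL2 (μ : Measure Ω) [IsProbabilityMeasure μ] {A : Set Ω}
    (hA : MeasurableSet A) : Lp ℝ 2 μ :=
  indicatorConstLp 2 hA (measure_ne_top μ A) (1 : ℝ)

theorem inner_indL2 {A B : Set Ω} (hA : MeasurableSet A) (hB : MeasurableSet B) :
    ⟪indL2 μ hA, indL2 μ hB⟫_ℝ = μ.real (A ∩ B) :=
  L2.real_inner_indicatorConstLp_one_indicatorConstLp_one hA hB _ _

theorem norm_sum_indL2_sq (hT : MeasurePreserving T μ μ) {C : Set Ω} (hC : MeasurableSet C)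
    (n : ℕ) :
    ‖∑ i ∈ Finset.range n, indL2 μ (hC.preimage (hT.iterate i).measurable)‖ ^ 2 =
      visitCorr μ T C n := by
  rw [← real_inner_self_eq_norm_sq, sum_inner]
  simp only [inner_sum, inner_indL2]
  rfl

theorem tendsto_visitCorr (hT : Ergodic T μ) {C : Set Ω} (hC : MeasurableSet C) :
    Tendsto (fun n : ℕ => visitCorr μ T C n / (n : ℝ) ^ 2) atTop (𝓝 (μ.real C ^ 2)) := by
  have hmp := hT.toMeasurePreserving
  have hiterate (i : ℕ) : (Lp.compMeasurePreserving T hmp)^[i] (indL2 μ hC) =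
      indL2 μ (hC.preimage (hmp.iterate i).measurable) := by
    rw [Lp.compMeasurePreserving_iterate]
    rfl
  have hmean : ∫ y, indL2 μ hC y ∂μ = μ.real C := by
    rw [integral_congr_ae indicatorConstLp_coeFn, integral_indicator_const _ hC, smul_eq_mul,
      mul_one]
  have hlim := (tendsto_birkhoffAverage_compMeasurePreserving hT (indL2 μ hC)).norm.pow 2
  rw [hmean, Lp.norm_const 2 μ _ two_ne_zero] at hlim
  simp only [probReal_univ, Real.one_rpow, mul_one, Real.norm_eq_abs, sq_abs] at hlim
  refine hlim.congr fun n => ?_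
  simp only [birkhoffAverage, birkhoffSum, id, hiterate]
  rw [norm_smul, mul_pow, norm_sum_indL2_sq hmp hC, norm_inv, inv_pow, div_eq_inv_mul]
  simp

theorem measureReal_inter_iInter_preimage_le_inter (hT : MeasurePreserving T μ μ) {C U : Set Ω}
    (hC : MeasurableSet C) (hU : MeasurableSet U) {j n : ℕ} (hj : j < n) :
    μ.real (C ∩ ⋂ i < n, T^[i] ⁻¹' U) ≤ μ.real (T^[n - 1] ⁻¹' U ∩ T^[j] ⁻¹' C) := by
  have hmeas : MeasurableSet (C ∩ ⋂ i < n, T^[i] ⁻¹' U) := hC.inter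
    (MeasurableSet.iInter fun i => .iInter fun _ => hU.preimage (hT.iterate i).measurable)
  rw [← (hT.iterate j).measureReal_preimage hmeas.nullMeasurableSet]
  refine measureReal_mono fun y ⟨hyC, hyU⟩ => ⟨?_, hyC⟩
  have hy := Set.mem_iInter₂.1 hyU (n - 1 - j) (by omega)
  rwa [Set.mem_preimage, ← Function.iterate_add_apply, Nat.sub_add_cancel (by omega)] at hy

/-- The point is in `U` at time `n - 1` whenever the orbit stays in `U` during the `n` steps after
a visit to `C`, so that the Cauchy-Schwarz inequality applies to `U` and the number of visits. -/
theorem measureReal_inter_iInter_preimage_le (hT : MeasurePreserving T μ μ) {C U : Set Ω}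
    (hC : MeasurableSet C) (hU : MeasurableSet U) (n : ℕ) :
    (n * μ.real (C ∩ ⋂ i < n, T^[i] ⁻¹' U)) ^ 2 ≤ μ.real U * visitCorr μ T C n := by
  have hUm : MeasurableSet (T^[n - 1] ⁻¹' U) := hU.preimage (hT.iterate _).measurable
  have hCm (j : ℕ) : MeasurableSet (T^[j] ⁻¹' C) := hC.preimage (hT.iterate j).measurable
  have hle : n * μ.real (C ∩ ⋂ i < n, T^[i] ⁻¹' U) ≤
      ⟪indL2 μ hUm, ∑ j ∈ Finset.range n, indL2 μ (hCm j)⟫_ℝ := by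
    simp only [inner_sum, inner_indL2, ← nsmul_eq_mul]
    rw [← Finset.card_range n, ← Finset.sum_const, Finset.card_range]
    exact Finset.sum_le_sum fun j hj =>
      measureReal_inter_iInter_preimage_le_inter hT hC hU (Finset.mem_range.1 hj)
  calc (n * μ.real (C ∩ ⋂ i < n, T^[i] ⁻¹' U)) ^ 2
      ≤ (‖indL2 μ hUm‖ * ‖∑ j ∈ Finset.range n, indL2 μ (hCm j)‖) ^ 2 :=
        pow_le_pow_left₀ (by positivity) (hle.trans (real_inner_le_norm _ _)) 2
    _ = μ.real U * visitCorr μ T C n := by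
        rw [mul_pow, norm_sum_indL2_sq hT hC, ← real_inner_self_eq_norm_sq, inner_indL2,
          Set.inter_self, (hT.iterate _).measureReal_preimage hU.nullMeasurableSet]

end MeanErgodic

section MaximalErgodic

variable {Ω : Type*} {T : Ω → Ω}

/-- The maximum of the Birkhoff sums of `F` over `0, ..., n` steps, which is the object of the
maximal ergodic theorem; the recursion starts the orbit one step later. -/
noncomputable def maxBirkhoffSum (T : Ω → Ω) (F : Ω → ℝ) : ℕ → Ω → ℝ
  | 0 => fun _ => 0
  | n + 1 => fun y => max 0 (F y + maxBirkhoffSum T F n (T y))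

variable {F : Ω → ℝ}

theorem maxBirkhoffSum_nonneg (n : ℕ) (y : Ω) : 0 ≤ maxBirkhoffSum T F n y := by
  cases n with
  | zero => exact le_rfl
  | succ n => exact le_max_left _ _

theorem maxBirkhoffSum_le_succ (n : ℕ) (y : Ω) :
    maxBirkhoffSum T F n y ≤ maxBirkhoffSum T F (n + 1) y := by
  induction n generalizing y with
  | zero => exact maxBirkhoffSum_nonneg 1 y
  | succ n ih => exact max_le_max le_rfl (add_le_add le_rfl (ih (T y)))

theorem birkhoffSum_le_maxBirkhoffSum (n : ℕ) (y : Ω) :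
    birkhoffSum T F n y ≤ maxBirkhoffSum T F n y := by
  induction n generalizing y with
  | zero => simp [maxBirkhoffSum]
  | succ n ih =>
    rw [birkhoffSum_succ']
    exact (add_le_add le_rfl (ih (T y))).trans (le_max_right _ _)

theorem maxBirkhoffSum_sub_le_indicator (n : ℕ) (y : Ω) :
    maxBirkhoffSum T F n y - maxBirkhoffSum T F n (T y) ≤
      {y | 0 < maxBirkhoffSum T F n y}.indicator F y := by
  rcases (maxBirkhoffSum_nonneg (T := T) (F := F) n y).eq_or_lt with hy | hy
  · rw [Set.indicator_of_notMem (by simp [← hy]), ← hy]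
    linarith [maxBirkhoffSum_nonneg (T := T) (F := F) n (T y)]
  · rw [Set.indicator_of_mem (by simpa using hy)]
    cases n with
    | zero => simp [maxBirkhoffSum] at hy
    | succ n =>
      have hmax : maxBirkhoffSum T F (n + 1) y = F y + maxBirkhoffSum T F n (T y) :=
        (max_choice 0 _).resolve_left hy.ne'
      linarith [maxBirkhoffSum_le_succ (T := T) (F := F) n (T y)]

variable [MeasurableSpace Ω] {μ : Measure Ω}

theorem integrable_maxBirkhoffSum (hT : MeasurePreserving T μ μ) (hF : Integrable F μ) (n : ℕ) :
    Integrable (maxBirkhoffSum T F n) μ := by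
  induction n with
  | zero => exact integrable_zero _ _ _
  | succ n ih =>
    exact (integrable_zero _ _ _).sup (hF.add ((hT.integrable_comp ih.aestronglyMeasurable).2 ih))

theorem measurableSet_maxBirkhoffSum_pos (hT : Measurable T) (hF : Measurable F) (n : ℕ) :
    MeasurableSet {y | 0 < maxBirkhoffSum T F n y} := by
  refine measurableSet_lt measurable_const ?_
  induction n with
  | zero => exact measurable_const
  | succ n ih => exact measurable_const.max (hF.add (ih.comp hT))

theorem setIntegral_maxBirkhoffSum_pos_nonneg (hT : MeasurePreserving T μ μ)
    (hF : Integrable F μ) (hFm : Measurable F) (n : ℕ) :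
    0 ≤ ∫ y in {y | 0 < maxBirkhoffSum T F n y}, F y ∂μ := by
  have hmeas := measurableSet_maxBirkhoffSum_pos hT.measurable hFm n
  have hM := integrable_maxBirkhoffSum hT hF n
  have hMT : Integrable (fun y => maxBirkhoffSum T F n (T y)) μ :=
    (hT.integrable_comp hM.aestronglyMeasurable).2 hM
  calc (0 : ℝ) = ∫ y, (maxBirkhoffSum T F n y - maxBirkhoffSum T F n (T y)) ∂μ := by
        rw [integral_sub hM hMT,
          integral_comp_of_measurePreserving hT hM.aestronglyMeasurable, sub_self]
    _ ≤ ∫ y, {y | 0 < maxBirkhoffSum T F n y}.indicator F y ∂μ :=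
        integral_mono (hM.sub hMT) (hF.indicator hmeas) (maxBirkhoffSum_sub_le_indicator n)
    _ = _ := integral_indicator hmeas

theorem integral_nonneg_of_ae_exists_birkhoffSum_pos (hT : MeasurePreserving T μ μ)
    (hF : Integrable F μ) (hFm : Measurable F) (h : ∀ᵐ y ∂μ, ∃ n, 0 < birkhoffSum T F n y) :
    0 ≤ ∫ y, F y ∂μ := by
  have hmono : Monotone fun n => {y | 0 < maxBirkhoffSum T F n y} :=
    monotone_nat_of_le_succ fun n y hy => lt_of_lt_of_le hy (maxBirkhoffSum_le_succ n y)
  have hlim := tendsto_setIntegral_of_monotone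
    (measurableSet_maxBirkhoffSum_pos hT.measurable hFm) hmono hF.integrableOn
  have huniv : (⋃ n, {y | 0 < maxBirkhoffSum T F n y}) =ᵐ[μ] Set.univ := by
    rw [eventuallyEq_univ]
    filter_upwards [h] with y ⟨n, hn⟩
    exact Set.mem_iUnion.2 ⟨n, hn.trans_le (birkhoffSum_le_maxBirkhoffSum n y)⟩
  rw [setIntegral_congr_set huniv, setIntegral_univ] at hlim
  exact ge_of_tendsto' hlim (setIntegral_maxBirkhoffSum_pos_nonneg hT hF hFm)

theorem measureReal_exists_lt_birkhoffSum_indicator_lt_one [IsProbabilityMeasure μ]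
    (hT : MeasurePreserving T μ μ) {O : Set Ω} (hO : MeasurableSet O) {q : ℝ}
    (hq : μ.real O < q) :
    μ.real {y | ∃ n : ℕ, q * n < birkhoffSum T (O.indicator 1) n y} < 1 := by
  have hind : Measurable (O.indicator (1 : Ω → ℝ)) := measurable_one.indicator hO
  have hint : Integrable (O.indicator (1 : Ω → ℝ)) μ := (integrable_const 1).indicator hO
  have hmeas : MeasurableSet {y | ∃ n : ℕ, q * n < birkhoffSum T (O.indicator 1) n y} := by
    simp only [Set.ofPred_exists]
    exact MeasurableSet.iUnion fun n => measurableSet_lt measurable_const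
      (Finset.measurable_sum _ fun i _ => hind.comp (hT.iterate i).measurable)
  refine lt_of_le_of_ne measureReal_le_one fun hone => hq.not_ge ?_
  have hae := (mem_ae_iff_prob_eq_one hmeas).2 ((ENNReal.toReal_eq_one_iff _).1 hone)
  have hnonneg : 0 ≤ ∫ y, (O.indicator 1 y - q) ∂μ := by
    refine integral_nonneg_of_ae_exists_birkhoffSum_pos hT (hint.sub (integrable_const q))
      (hind.sub measurable_const) ?_
    filter_upwards [hae] with y ⟨n, hn⟩
    refine ⟨n, ?_⟩
    simp only [birkhoffSum, Finset.sum_sub_distrib, Finset.sum_const, Finset.card_range,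
      nsmul_eq_mul] at hn ⊢
    linarith
  rwa [integral_sub hint (integrable_const q), integral_indicator_one hO, integral_const,
    probReal_univ, one_smul, sub_nonneg] at hnonneg

end MaximalErgodic

/-! ### Second moments of the number of occurrences of a string -/

section Words

/-- A list of all strings of length `n`, for computing sums over them. -/
def words (D : ℕ) : ℕ → List (List (Fin D))
  | 0 => [[]]
  | n + 1 => (words D n).flatMap fun w => (List.finRange D).map fun a => w ++ [a]

theorem mem_words {n : ℕ} {w : List (Fin D)} : w ∈ words D n ↔ w.length = n := by
  induction n generalizing w with
  | zero => simp [words]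
  | succ n ih =>
    simp only [words, List.mem_flatMap, ih, List.mem_map, List.mem_finRange, true_and]
    constructor
    · rintro ⟨v, rfl, a, rfl⟩
      simp
    · intro h
      have hw : w ≠ [] := by
        rintro rfl
        simp at h
      exact ⟨w.dropLast, by simp [h], w.getLast hw, w.dropLast_append_getLast hw⟩

theorem nodup_words (D n : ℕ) : (words D n).Nodup := by
  induction n with
  | zero => simp [words]
  | succ n ih =>
    have happend (w : List (Fin D)) : Function.Injective fun a => w ++ [a] :=
      fun a b h => by simpa using h
    refine List.nodup_flatMap.2 ⟨fun w _ => (List.nodup_finRange D).map (happend w),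
      ih.imp fun hvw => ?_⟩
    simp only [Function.onFun, List.disjoint_left, List.mem_map]
    rintro _ ⟨a, -, rfl⟩ ⟨b, -, h⟩
    exact hvw (by simpa using congrArg List.dropLast h.symm)

theorem primrec_words (D : ℕ) : Primrec (words D) := by
  have hstep : Primrec₂ fun (_ : ℕ) (l : List (List (Fin D))) =>
      l.flatMap fun w => (List.finRange D).map fun a => w ++ [a] :=
    (Primrec.list_flatMap Primrec.snd (Primrec.list_map (Primrec.const _)
      (Primrec.list_append.comp (Primrec.snd.comp Primrec.fst)
        (Primrec.list_cons.comp Primrec.snd (Primrec.const []))).to₂).to₂).to₂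
  refine (Primrec.nat_rec₁ [[]] hstep).of_eq fun n => ?_
  induction n with
  | zero => rfl
  | succ n ih => rw [words, ← ih]

variable {P : ProbabilityMeasure (BiSeq D)}

theorem measureReal_block_mem_list (hP : MeasurePreserving shift (P : Measure (BiSeq D)) P) (j : ℤ)
    {n : ℕ} {l : List (List (Fin D))} (hl : l.Nodup) (hlen : ∀ w ∈ l, w.length = n) :
    (P : Measure (BiSeq D)).real {x | block x j n ∈ l} = (l.map (blockProb P 1)).sum := by
  induction l with
  | nil => simp
  | cons w l ih =>
    have hunion : {x : BiSeq D | block x j n ∈ w :: l} =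
        {x | block x j n = w} ∪ {x | block x j n ∈ l} := by
      ext x
      simp
    have hdisj : Disjoint {x : BiSeq D | block x j n = w} {x | block x j n ∈ l} :=
      Set.disjoint_left.2 fun x hx hxl => (List.nodup_cons.1 hl).1 (hx ▸ hxl)
    rw [hunion, measureReal_union hdisj (measurableSet_block_mem j n {v | v ∈ l}),
      measureReal_block_eq hP j (hlen w List.mem_cons_self),
      ih (List.nodup_cons.1 hl).2 fun v hv => hlen v (List.mem_cons_of_mem w hv), List.map_cons,
      List.sum_cons]

end Words

section Occurrences

/-- The strings of length `n + |w|` in which `w` occurs after `i` and after `j` letters. -/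
def doubleOccurrences (w : List (Fin D)) (n i j : ℕ) : List (List (Fin D)) :=
  (words D (n + w.length)).filter fun v =>
    (v.drop i).take w.length = w ∧ (v.drop j).take w.length = w

/-- The second moment of the number of occurrences of `w` at the positions `1, ..., n` is the sum of
the probabilities of these strings, counted with multiplicity. -/
def visitStrings (w : List (Fin D)) (n : ℕ) : List (List (Fin D)) :=
  (List.range n).flatMap fun i => (List.range n).flatMap fun j => doubleOccurrences w n i j

theorem primrec_visitStrings :
    Primrec fun q : List (Fin D) × ℕ => visitStrings q.1 q.2 := by
  have hocc {f : List (Fin D) × (List (Fin D) × ℕ) × ℕ × ℕ → ℕ} (hf : Primrec f) :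
      PrimrecPred fun z : List (Fin D) × (List (Fin D) × ℕ) × ℕ × ℕ =>
        (z.1.drop (f z)).take z.2.1.1.length = z.2.1.1 := by
    have hw : Primrec fun z : List (Fin D) × (List (Fin D) × ℕ) × ℕ × ℕ => z.2.1.1 :=
      Primrec.fst.comp (Primrec.fst.comp Primrec.snd)
    exact Primrec.eq.comp (Primrec.list_take.comp (Primrec.list_length.comp hw)
      (Primrec.list_drop.comp hf Primrec.fst)) hw
  have hboth : PrimrecRel fun (v : List (Fin D)) (p : (List (Fin D) × ℕ) × ℕ × ℕ) =>
      (v.drop p.2.1).take p.1.1.length = p.1.1 ∧ (v.drop p.2.2).take p.1.1.length = p.1.1 :=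
    (hocc (Primrec.fst.comp (Primrec.snd.comp Primrec.snd))).and
      (hocc (Primrec.snd.comp (Primrec.snd.comp Primrec.snd)))
  have hdouble : Primrec fun p : (List (Fin D) × ℕ) × ℕ × ℕ =>
      doubleOccurrences p.1.1 p.1.2 p.2.1 p.2.2 :=
    hboth.listFilter.comp ((primrec_words D).comp (Primrec.nat_add.comp
      (Primrec.snd.comp Primrec.fst) (Primrec.list_length.comp (Primrec.fst.comp Primrec.fst))))
      Primrec.id
  exact Primrec.list_flatMap (Primrec.list_range.comp Primrec.snd) (Primrec.list_flatMap
    (Primrec.list_range.comp (Primrec.snd.comp Primrec.fst)) (hdouble.comp ((Primrec.fst.comp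
      Primrec.fst).pair ((Primrec.snd.comp Primrec.fst).pair Primrec.snd))).to₂).to₂

variable {P : ProbabilityMeasure (BiSeq D)}

theorem sum_map_blockProb_visitStrings (hP : MeasurePreserving shift (P : Measure (BiSeq D)) P)
    (w : List (Fin D)) (n : ℕ) : ((visitStrings w n).map (blockProb P 1)).sum =
      visitCorr (P : Measure (BiSeq D)) shift {x | block x 1 w.length = w} n := by
  have hdouble {i j : ℕ} (hi : i < n) (hj : j < n) :
      ((doubleOccurrences w n i j).map (blockProb P 1)).sum = (P : Measure (BiSeq D)).real
        (shift^[i] ⁻¹' {x | block x 1 w.length = w} ∩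
          shift^[j] ⁻¹' {x | block x 1 w.length = w}) := by
    rw [doubleOccurrences, ← measureReal_block_mem_list hP 1 ((nodup_words D _).filter _)
      (fun v hv => mem_words.1 (List.mem_filter.1 hv).1)]
    congr 1
    ext x
    simp only [List.mem_filter, mem_words, length_block, decide_eq_true_eq,
      Set.mem_ofPred_eq, true_and, Set.mem_inter_iff, Set.mem_preimage, block_iterate_shift,
      take_drop_block x 1 (show i + w.length ≤ n + w.length by omega),
      take_drop_block x 1 (show j + w.length ≤ n + w.length by omega)]
  have hsum (f : ℕ → List (List (Fin D))) (n : ℕ) :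
      (((List.range n).flatMap f).map (blockProb P 1)).sum =
        ∑ i ∈ Finset.range n, ((f i).map (blockProb P 1)).sum := by
    rw [List.map_flatMap, List.flatMap_def, List.sum_flatten, List.map_map]
    rfl
  rw [visitStrings, hsum]
  refine Finset.sum_congr rfl fun i hi => ?_
  rw [hsum]
  exact Finset.sum_congr rfl fun j hj => hdouble (Finset.mem_range.1 hi) (Finset.mem_range.1 hj)

theorem exists_nat_div_btwn {a r : ℝ} (hr : 0 < r) (ha : a < r) :
    ∃ m n : ℕ, 0 < n ∧ a < (m : ℝ) / n ∧ (m : ℝ) / n < r := by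
  obtain ⟨q, hq, hqr⟩ := exists_rat_btwn (max_lt ha hr)
  lift q to ℚ≥0 using by exact_mod_cast ((le_max_right a 0).trans_lt hq).le
  refine ⟨q.num, q.den, q.den_pos, ?_⟩
  have hqe : (q.num : ℝ) / q.den = ((q : ℚ) : ℝ) := by
    rw [← NNRat.cast_def]
    rfl
  rw [hqe]
  exact ⟨(le_max_left a 0).trans_lt hq, hqr⟩

theorem exists_mul_visitCorr_lt {Ω : Type*} [MeasurableSpace Ω] {μ : Measure Ω}
    [IsProbabilityMeasure μ] {T : Ω → Ω} (hT : Ergodic T μ) {C : Set Ω} (hC : MeasurableSet C)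
    (hpos : 0 < μ.real C) (k : ℕ) :
    ∃ n b c : ℕ, 0 < n ∧ b < c * μ.real C ∧
      k * c ^ 2 * visitCorr μ T C n < (k + 1) * n ^ 2 * (b : ℝ) ^ 2 := by
  have hsqrt : √(k / (k + 1)) * μ.real C < μ.real C := by
    refine mul_lt_of_lt_one_left hpos ((Real.sqrt_lt' one_pos).2 ?_)
    rw [one_pow, div_lt_one (by positivity)]
    exact lt_add_one _
  obtain ⟨b, c, hc, hlt, hbc⟩ := exists_nat_div_btwn hpos hsqrt
  have hc' : (0 : ℝ) < c := by exact_mod_cast hc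
  have hlim : k * μ.real C ^ 2 < (k + 1) * ((b : ℝ) / c) ^ 2 := by
    have h := pow_lt_pow_left₀ hlt (by positivity) two_ne_zero
    rw [mul_pow, Real.sq_sqrt (by positivity), div_mul_eq_mul_div, div_lt_iff₀ (by positivity)] at h
    linarith
  obtain ⟨n, hlt, hn⟩ := ((((tendsto_visitCorr hT hC).const_mul
    (k : ℝ)).eventually_lt_const hlim).and (eventually_gt_atTop 0)).exists
  refine ⟨n, b, c, hn, by rwa [div_lt_iff₀' hc'] at hbc, ?_⟩
  have hn' : (0 : ℝ) < n := by exact_mod_cast hn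
  field_simp at hlt
  linarith

variable {s : BiSeq D}

theorem IsRepresentation.ceIn_mul_visitCorr_lt (hs : IsRepresentation s P)
    (hP : MeasurePreserving shift (P : Measure (BiSeq D)) P) (k : ℕ) :
    CEIn s fun q : (List (Fin D) × ℕ) × ℕ × ℕ =>
      k * (q.2.2 : ℝ) ^ 2 * visitCorr P shift {x | block x 1 q.1.1.length = q.1.1} q.1.2 <
        (k + 1) * (q.1.2 : ℝ) ^ 2 * (q.2.1 : ℝ) ^ 2 := by
  have hn : Primrec fun z : (List (Fin D) × ℕ) × ℕ × ℕ => z.1.2 := Primrec.snd.comp Primrec.fst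
  have hb : Primrec fun z : (List (Fin D) × ℕ) × ℕ × ℕ => z.2.1 := Primrec.fst.comp Primrec.snd
  have hc : Primrec fun z : (List (Fin D) × ℕ) × ℕ × ℕ => z.2.2 := Primrec.snd.comp Primrec.snd
  have hsq {f : (List (Fin D) × ℕ) × ℕ × ℕ → ℕ} (hf : Primrec f) : Primrec fun z => f z ^ 2 :=
    (Primrec.nat_mul.comp hf hf).of_eq fun z => (sq (f z)).symm
  refine (hs.ceIn_mul_sum_blockProb_lt
    (Primrec.nat_mul.comp (Primrec.const k) (hsq hc)).to_comp
    (primrec_visitStrings.comp Primrec.fst).to_comp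
    (Primrec.nat_mul.comp (Primrec.nat_mul.comp (Primrec.const (k + 1)) (hsq hn)) (hsq hb)).to_comp
    (Computable.const [[]])).of_iff fun q => ?_
  simp [sum_map_blockProb_visitStrings hP]

theorem exists_ceIn_visitCorr_le (hs : IsRepresentation s P) (hP : StationaryErgodic P)
    (k : ℕ) : ∃ N : List (Fin D) × ℕ → Prop, CEIn s N ∧
      (∀ w n, N (w, n) → 0 < n ∧ k * visitCorr P shift {x | block x 1 w.length = w} n ≤
        (k + 1) * n ^ 2 * blockProb P 1 w ^ 2) ∧
      ∀ w, 0 < blockProb P 1 w → ∃ n, N (w, n) := by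
  let N (q : List (Fin D) × ℕ) : Prop := 0 < q.2 ∧ ∃ p : ℕ × ℕ, p.1 < p.2 * blockProb P 1 q.1 ∧
      k * p.2 ^ 2 * visitCorr P shift {x | block x 1 q.1.length = q.1} q.2 <
        (k + 1) * q.2 ^ 2 * (p.1 : ℝ) ^ 2
  refine ⟨N, ?_, ?_, ?_⟩
  · have hlower : CEIn s fun q : (List (Fin D) × ℕ) × ℕ × ℕ =>
        (q.2.1 : ℝ) < q.2.2 * blockProb P 1 q.1.1 := by
      refine (hs.ceIn_mul_sum_blockProb_lt (Primrec.fst.comp Primrec.snd).to_comp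
        (Computable.const [[]]) (Primrec.snd.comp Primrec.snd).to_comp
        (Primrec.list_cons.comp (Primrec.fst.comp Primrec.fst)
          (Primrec.const [])).to_comp).of_iff fun q => ?_
      simp
    exact .and (.of_primrecPred (Primrec.nat_lt.comp (Primrec.const 0) Primrec.snd))
      (hlower.and (hs.ceIn_mul_visitCorr_lt hP.toMeasurePreserving k)).ex
  · rintro w n ⟨hn, ⟨b, c⟩, hb, hlt⟩
    dsimp only at hn hb hlt
    have hc : (0 : ℝ) < c := by
      refine pos_of_mul_pos_left ((Nat.cast_nonneg b).trans_lt hb) (blockProb_nonneg P 1 w)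
    have hbc : (b : ℝ) ^ 2 ≤ (c * blockProb P 1 w) ^ 2 := pow_le_pow_left₀ b.cast_nonneg hb.le 2
    refine ⟨hn, le_of_mul_le_mul_left ?_ (pow_pos hc 2)⟩
    calc (c : ℝ) ^ 2 * (k * visitCorr P shift {x | block x 1 w.length = w} n)
        = k * c ^ 2 * visitCorr P shift {x | block x 1 w.length = w} n := by ring
      _ ≤ (k + 1) * n ^ 2 * (b : ℝ) ^ 2 := hlt.le
      _ ≤ (k + 1) * n ^ 2 * (c * blockProb P 1 w) ^ 2 := by gcongr
      _ = _ := by ring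
  · intro w hw
    obtain ⟨n, b, c, h⟩ := exists_mul_visitCorr_lt hP (measurableSet_block_eq 1 _ w) hw k
    exact ⟨n, h.1, (b, c), h.2⟩

end Occurrences

/-! ### Random orbits leave every c.e. open set of measure less than one -/

section PrefixFree

open scoped ENNReal

/-- The central segments of a point that satisfy `V` are at most one: the basic open sets given by
the strings in `V` are disjoint. -/
def PrefixFree (V : List (Fin D) → Prop) : Prop :=
  ∀ (y : BiSeq D) (k k' : ℕ), V (segment y k) → V (segment y k') → k = k'

section Selection

variable {α : Type*} [Primcodable α] {s : BiSeq D} {G : α × List (Fin D) → Prop}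

theorem CEIn.exists_decidable_openSet_eq (hG : CEIn s G) :
    ∃ H : α × List (Fin D) → Prop, CEIn s H ∧ CEIn s (fun q => ¬ H q) ∧
      ∀ a, openSet (fun u => H (a, u)) = openSet fun u => G (a, u) := by
  obtain ⟨B, hB, hmono, hGB⟩ := hG.exists_primrecPred_mono
  -- `H (a, u)` says that `G` is confirmed for `a` and a central part of `u` by the time `|u| / 2`.
  let H (q : α × List (Fin D)) : Prop := ∃ m ∈ List.range (q.2.length / 2 + 1),
    B ((q.1, subsegment 0 m q.2), segment s (q.2.length / 2))
  have hH (a : α) (y : BiSeq D) (k : ℕ) :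
      H (a, segment y k) ↔ ∃ m ≤ k, B ((a, segment y m), segment s k) := by
    simp only [H, half_length_segment, List.mem_range, Nat.lt_succ_iff]
    exact exists_congr fun m => and_congr_right fun hm => by rw [subsegment_zero_segment y hm]
  have hrel : PrimrecRel fun (m : ℕ) (z : ((α × List (Fin D)) × ℕ) × List (Fin D)) =>
      B ((z.1.1.1, subsegment 0 m z.1.1.2), z.2) := by
    have ha : Primrec fun q : ℕ × ((α × List (Fin D)) × ℕ) × List (Fin D) => q.2.1.1 :=
      Primrec.fst.comp (Primrec.fst.comp Primrec.snd)
    exact hB.comp (((Primrec.fst.comp ha).pair (primrec_subsegment.comp ((Primrec.const 0).pair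
      (Primrec.fst.pair (Primrec.snd.comp ha))))).pair (Primrec.snd.comp Primrec.snd))
  have hdec : PrimrecPred fun z : ((α × List (Fin D)) × ℕ) × List (Fin D) =>
      ∃ m ∈ List.range (z.1.2 + 1), B ((z.1.1.1, subsegment 0 m z.1.1.2), z.2) :=
    hrel.exists_mem_list.comp (Primrec.list_range.comp (Primrec.succ.comp
      (Primrec.snd.comp Primrec.fst))) Primrec.id
  have hhalf : Computable fun q : α × List (Fin D) => (q, q.2.length / 2) :=
    (Primrec.id.pair (Primrec.nat_div.comp (Primrec.list_length.comp Primrec.snd)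
      (Primrec.const 2))).to_comp
  refine ⟨H, (CEIn.decide_segment hdec).comp hhalf, (CEIn.decide_segment hdec.not).comp hhalf,
    fun a => Set.ext fun y => ?_⟩
  simp only [openSet, Set.mem_ofPred_eq, hH, hGB]
  constructor
  · rintro ⟨k, m, -, hm⟩
    exact ⟨m, k, hm⟩
  · rintro ⟨m, k, hk⟩
    exact ⟨max m k, m, le_max_left m k, hmono _ (le_max_right m k) hk⟩

theorem CEIn.exists_prefixFree (hG : CEIn s G) :
    ∃ F : α × List (Fin D) → Prop, CEIn s F ∧ ∀ a, PrefixFree (fun u => F (a, u)) ∧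
      openSet (fun u => F (a, u)) = openSet fun u => G (a, u) := by
  obtain ⟨H, hH, hH', hHG⟩ := hG.exists_decidable_openSet_eq
  let F (q : α × List (Fin D)) : Prop :=
    H q ∧ ∀ k < q.2.length / 2, ¬ H (q.1, subsegment 0 k q.2)
  have hF (a : α) (y : BiSeq D) (k : ℕ) : F (a, segment y k) ↔
      H (a, segment y k) ∧ ∀ i < k, ¬ H (a, segment y i) := by
    simp only [F, half_length_segment]
    refine and_congr_right fun _ => forall₂_congr fun i hi => ?_
    rw [subsegment_zero_segment y hi.le]
  have hearlier : CEIn s fun z : (α × List (Fin D)) × ℕ => ¬ H (z.1.1, subsegment 0 z.2 z.1.2) :=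
    hH'.comp (f := fun z : (α × List (Fin D)) × ℕ => (z.1.1, subsegment 0 z.2 z.1.2))
      ((Primrec.fst.comp Primrec.fst).pair (primrec_subsegment.comp ((Primrec.const 0).pair
        (Primrec.snd.pair (Primrec.snd.comp Primrec.fst))))).to_comp
  refine ⟨F, hH.and (hearlier.forall_lt.comp (Primrec.id.pair (Primrec.nat_div.comp
    (Primrec.list_length.comp Primrec.snd) (Primrec.const 2))).to_comp), fun a => ⟨?_, ?_⟩⟩
  · intro y k k' hk hk'
    obtain ⟨hk, hlt⟩ := (hF a y k).1 hk
    obtain ⟨hk', hlt'⟩ := (hF a y k').1 hk'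
    exact le_antisymm (not_lt.1 fun h => hlt k' h hk') (not_lt.1 fun h => hlt' k h hk)
  · rw [← hHG]
    ext y
    simp only [openSet, Set.mem_ofPred_eq, hF]
    refine ⟨fun ⟨k, hk, _⟩ => ⟨k, hk⟩, fun hex => ?_⟩
    classical
    exact ⟨Nat.find hex, Nat.find_spec hex, fun i hi => Nat.find_min hex hi⟩

end Selection

theorem PrefixFree.measure_openSet {V : List (Fin D) → Prop} (hV : PrefixFree V)
    (μ : Measure (BiSeq D)) :
    μ (openSet V) = ∑' w : {w // V w}, μ {y | segment y (w.1.length / 2) = w.1} := by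
  have hunion : openSet V = ⋃ w : {w // V w}, {y | segment y (w.1.length / 2) = w.1} := by
    ext y
    simp only [openSet, Set.mem_ofPred_eq, Set.mem_iUnion, Subtype.exists, exists_prop]
    constructor
    · rintro ⟨k, hk⟩
      exact ⟨_, hk, by rw [half_length_segment]⟩
    · rintro ⟨w, hw, hy⟩
      exact ⟨_, hy.symm ▸ hw⟩
  rw [hunion]
  refine measure_iUnion (fun w w' hww => Set.disjoint_left.2 fun y hy hy' => hww ?_)
    fun w => measurableSet_segment_eq _ _
  have hlen := hV y _ _ (hy.symm ▸ w.2) (hy'.symm ▸ w'.2)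
  exact Subtype.ext (hy.symm.trans ((congrArg (segment y) hlen).trans hy'))

variable {A : List (Fin D) → Prop} {F : List (Fin D) × List (Fin D) → Prop}

theorem PrefixFree.reachedIn (hA : PrefixFree A) (hF : ∀ w, PrefixFree fun u => F (w, u))
    (hsub : ∀ w, openSet (fun u => F (w, u)) ⊆ {y | segment y (w.length / 2) = w}) (m : ℕ) :
    PrefixFree (ReachedIn A F m) := by
  induction m with
  | zero => exact hA
  | succ m ih =>
    rintro y k k' ⟨w, hw, hk⟩ ⟨w', hw', hk'⟩
    have hy : segment y (w.length / 2) = w := hsub w ⟨k, hk⟩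
    have hy' : segment y (w'.length / 2) = w' := hsub w' ⟨k', hk'⟩
    have hlen := ih y _ _ (hy.symm ▸ hw) (hy'.symm ▸ hw')
    obtain rfl : w = w' := hy.symm.trans ((congrArg (segment y) hlen).trans hy')
    exact hF w y k k' hk hk'

theorem measure_openSet_reachedIn_le (hA : PrefixFree A) (hF : ∀ w, PrefixFree fun u => F (w, u))
    (hsub : ∀ w, openSet (fun u => F (w, u)) ⊆ {y | segment y (w.length / 2) = w})
    {μ : Measure (BiSeq D)} {r : ℝ≥0∞} (hr : ∀ w, μ (openSet fun u => F (w, u)) ≤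
      r * μ {y | segment y (w.length / 2) = w}) (m : ℕ) :
    μ (openSet (ReachedIn A F m)) ≤ r ^ m * μ (openSet A) := by
  induction m with
  | zero => simp [ReachedIn]
  | succ m ih =>
    have hcover : openSet (ReachedIn A F (m + 1)) ⊆
        ⋃ w : {w // ReachedIn A F m w}, openSet fun u => F (w.1, u) := by
      rintro y ⟨k, w, hw, hk⟩
      exact Set.mem_iUnion.2 ⟨⟨w, hw⟩, k, hk⟩
    calc μ (openSet (ReachedIn A F (m + 1)))
        ≤ ∑' w : {w // ReachedIn A F m w}, μ (openSet fun u => F (w.1, u)) :=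
          (measure_mono hcover).trans (measure_iUnion_le _)
      _ ≤ ∑' w : {w // ReachedIn A F m w}, r * μ {y | segment y (w.1.length / 2) = w.1} :=
          ENNReal.tsum_le_tsum fun w => hr w.1
      _ = r * μ (openSet (ReachedIn A F m)) := by
          rw [ENNReal.tsum_mul_left, (hA.reachedIn hF hsub m).measure_openSet]
      _ ≤ r * (r ^ m * μ (openSet A)) := mul_le_mul_right ih r
      _ = r ^ (m + 1) * μ (openSet A) := by rw [pow_succ', mul_assoc]

end PrefixFree

section Escape

/-- The string `u`, seen as a central segment of a point, shows that the point is in `openSet V`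
after `i` shifts. -/
def Witnesses (V : List (Fin D) → Prop) (u : List (Fin D)) (i : ℕ) : Prop :=
  ∃ m, i + m ≤ u.length / 2 ∧ V (subsegment i m u)

variable {s x : BiSeq D} {P : ProbabilityMeasure (BiSeq D)} {V : List (Fin D) → Prop}

theorem CEIn.witnesses (hV : CEIn s V) :
    CEIn s fun q : List (Fin D) × ℕ => Witnesses V q.1 q.2 := by
  refine CEIn.ex (A := fun z : (List (Fin D) × ℕ) × ℕ =>
    z.1.2 + z.2 ≤ z.1.1.length / 2 ∧ V (subsegment z.1.2 z.2 z.1.1)) (.and ?_ ?_)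
  · exact .of_primrecPred (Primrec.nat_le.comp
      (Primrec.nat_add.comp (Primrec.snd.comp Primrec.fst) Primrec.snd)
      (Primrec.nat_div.comp (Primrec.list_length.comp (Primrec.fst.comp Primrec.fst))
        (Primrec.const 2)))
  · exact hV.comp (f := fun z : (List (Fin D) × ℕ) × ℕ => subsegment z.1.2 z.2 z.1.1)
      (primrec_subsegment.comp ((Primrec.snd.comp Primrec.fst).pair
        (Primrec.snd.pair (Primrec.fst.comp Primrec.fst)))).to_comp

theorem witnesses_segment_iff (y : BiSeq D) (i k : ℕ) :
    Witnesses V (segment y k) i ↔ ∃ m, i + m ≤ k ∧ V (segment (shift^[i] y) m) := by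
  rw [Witnesses, half_length_segment]
  exact exists_congr fun m => and_congr_right fun hm => by rw [subsegment_segment y hm]

theorem Witnesses.iterate_shift_mem {y : BiSeq D} {i k : ℕ} (h : Witnesses V (segment y k) i) :
    shift^[i] y ∈ openSet V := by
  obtain ⟨m, -, hm⟩ := (witnesses_segment_iff y i k).1 h
  exact ⟨m, hm⟩

theorem eventually_witnesses_segment {y : BiSeq D} {i : ℕ} (h : shift^[i] y ∈ openSet V) :
    ∀ᶠ k in atTop, Witnesses V (segment y k) i := by
  obtain ⟨m, hm⟩ := h
  filter_upwards [eventually_ge_atTop (i + m)] with k hk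
  exact (witnesses_segment_iff y i k).2 ⟨m, hk, hm⟩

theorem CEIn.exists_openSet_eq_stay (hV : CEIn s V) {N : List (Fin D) × ℕ → Prop}
    (hN : CEIn s N) :
    ∃ G : List (Fin D) × List (Fin D) → Prop, CEIn s G ∧ ∀ w, openSet (fun u => G (w, u)) =
      {y | segment y (w.length / 2) = w ∧ ∃ n, N (w, n) ∧ ∀ i < n, shift^[i] y ∈ openSet V} := by
  let Centered (q : List (Fin D) × List (Fin D)) : Prop :=
    q.1.length / 2 ≤ q.2.length / 2 ∧ subsegment 0 (q.1.length / 2) q.2 = q.1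
  have hCentered : PrimrecPred Centered := by
    have hhalf {f : List (Fin D) × List (Fin D) → List (Fin D)} (hf : Primrec f) :
        Primrec fun q => (f q).length / 2 :=
      Primrec.nat_div.comp (Primrec.list_length.comp hf) (Primrec.const 2)
    exact (Primrec.nat_le.comp (hhalf Primrec.fst) (hhalf Primrec.snd)).and (Primrec.eq.comp
      (primrec_subsegment.comp ((Primrec.const 0).pair ((hhalf Primrec.fst).pair Primrec.snd)))
      Primrec.fst)
  have hstay : CEIn s fun z : (List (Fin D) × List (Fin D)) × ℕ =>
      N (z.1.1, z.2) ∧ ∀ i < z.2, Witnesses V z.1.2 i :=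
    .and (hN.comp ((Computable.fst.comp Computable.fst).pair Computable.snd))
      (hV.witnesses.forall_lt.comp ((Computable.snd.comp Computable.fst).pair Computable.snd))
  refine ⟨fun q => Centered q ∧ ∃ n, N (q.1, n) ∧ ∀ i < n, Witnesses V q.2 i,
    (CEIn.of_primrecPred hCentered).and hstay.ex, fun w => Set.ext fun y => ?_⟩
  have hcentered (k : ℕ) : Centered (w, segment y k) ↔
      w.length / 2 ≤ k ∧ segment y (w.length / 2) = w := by
    simp only [Centered, half_length_segment]
    exact and_congr_right fun hk => by rw [subsegment_zero_segment y hk]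
  simp only [openSet, Set.mem_ofPred_eq, hcentered]
  constructor
  · rintro ⟨k, ⟨-, hw⟩, n, hn, hall⟩
    exact ⟨hw, n, hn, fun i hi => (hall i hi).iterate_shift_mem⟩
  · rintro ⟨hw, n, hn, hall⟩
    have hlarge : ∀ᶠ k in atTop, ∀ i ∈ Set.Iio n, Witnesses V (segment y k) i :=
      (Set.finite_Iio n).eventually_all.2 fun i hi => eventually_witnesses_segment (hall i hi)
    obtain ⟨k, hk, hwit⟩ := ((eventually_ge_atTop (w.length / 2)).and hlarge).exists
    exact ⟨k, ⟨hk, hw⟩, n, hn, hwit⟩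

theorem visitCorr_segment_eq (hP : MeasurePreserving shift (P : Measure (BiSeq D)) P)
    {w : List (Fin D)} {k : ℕ} (hw : w.length = 2 * k + 1) (n : ℕ) :
    visitCorr P shift {y | segment y k = w} n =
      visitCorr P shift {y | block y 1 w.length = w} n := by
  rw [← visitCorr_preimage_iterate hP (measurableSet_segment_eq k w) (k + 1)]
  congr 1
  ext y
  simp only [Set.mem_preimage, Set.mem_ofPred_eq, segment, block_iterate_shift, hw]
  push_cast
  rw [neg_add_cancel_left]

theorem measureReal_segment_eq_inter_stay_le
    (hP : MeasurePreserving shift (P : Measure (BiSeq D)) P) {k n : ℕ} {r : ℝ} (hr0 : 0 ≤ r)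
    (hr : (P : Measure (BiSeq D)).real (openSet V) * (k + 1) ≤ r ^ 2 * k) (hk : 0 < k) (hn : 0 < n)
    {w : List (Fin D)} (hcorr : k * visitCorr P shift {y | block y 1 w.length = w} n ≤
      (k + 1) * n ^ 2 * blockProb P 1 w ^ 2) :
    (P : Measure (BiSeq D)).real {y | segment y (w.length / 2) = w ∧
      ∀ i < n, shift^[i] y ∈ openSet V} ≤
        r * (P : Measure (BiSeq D)).real {y | segment y (w.length / 2) = w} := by
  have hset : {y | segment y (w.length / 2) = w ∧ ∀ i < n, shift^[i] y ∈ openSet V} =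
      {y | segment y (w.length / 2) = w} ∩ ⋂ i < n, shift^[i] ⁻¹' openSet V := by
    ext y
    simp
  by_cases hw : w.length = 2 * (w.length / 2) + 1
  · have hschwarz := measureReal_inter_iInter_preimage_le hP
      (measurableSet_segment_eq (w.length / 2) w) (measurableSet_openSet V) n
    rw [visitCorr_segment_eq hP hw, ← hset] at hschwarz
    have hprob : (P : Measure (BiSeq D)).real {y | segment y (w.length / 2) = w} =
        blockProb P 1 w := measureReal_block_eq hP _ hw
    rw [hprob]
    refine (pow_le_pow_iff_left₀ measureReal_nonneg
      (mul_nonneg hr0 (blockProb_nonneg P 1 w)) two_ne_zero).1 (le_of_mul_le_mul_left ?_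
        (show (0 : ℝ) < k * n ^ 2 by positivity))
    set E := {y | segment y (w.length / 2) = w ∧ ∀ i < n, shift^[i] y ∈ openSet V}
    set μ := (P : Measure (BiSeq D))
    calc k * n ^ 2 * μ.real E ^ 2
        = k * (n * μ.real E) ^ 2 := by ring
      _ ≤ k * (μ.real (openSet V) * visitCorr μ shift {y | block y 1 w.length = w} n) := by gcongr
      _ = μ.real (openSet V) * (k * visitCorr μ shift {y | block y 1 w.length = w} n) := by ring
      _ ≤ μ.real (openSet V) * ((k + 1) * n ^ 2 * blockProb P 1 w ^ 2) := by gcongr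
      _ = μ.real (openSet V) * (k + 1) * (n ^ 2 * blockProb P 1 w ^ 2) := by ring
      _ ≤ r ^ 2 * k * (n ^ 2 * blockProb P 1 w ^ 2) := by gcongr
      _ = k * n ^ 2 * (r * blockProb P 1 w) ^ 2 := by ring
  · have hempty : {y : BiSeq D | segment y (w.length / 2) = w} = ∅ :=
      Set.eq_empty_of_forall_notMem fun y hy => hw (by
        rw [← length_segment y, hy])
    rw [hset, hempty, Set.empty_inter, measureReal_empty, mul_zero]

theorem exists_refinement (hs : IsRepresentation s P) (hP : StationaryErgodic P) (hV : CEIn s V)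
    (hO : (P : Measure (BiSeq D)).real (openSet V) < 1) :
    ∃ (r : ℝ) (F : List (Fin D) × List (Fin D) → Prop), 0 ≤ r ∧ r < 1 ∧ CEIn s F ∧
      ∀ w, PrefixFree (fun u => F (w, u)) ∧
        openSet (fun u => F (w, u)) ⊆ {y | segment y (w.length / 2) = w} ∧
        (P : Measure (BiSeq D)).real (openSet fun u => F (w, u)) ≤
          r * (P : Measure (BiSeq D)).real {y | segment y (w.length / 2) = w} ∧
        (0 < blockProb P 1 w → ∀ y, segment y (w.length / 2) = w →
          (∀ i, shift^[i] y ∈ openSet V) → y ∈ openSet fun u => F (w, u)) := by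
  have hmp := hP.toMeasurePreserving
  set p := (P : Measure (BiSeq D)).real (openSet V)
  obtain ⟨k, hk⟩ := exists_nat_gt (p / (1 - p))
  rw [div_lt_iff₀ (sub_pos.2 hO)] at hk
  have hp0 : 0 ≤ p := measureReal_nonneg
  have hk0 : (0 : ℝ) < k := by nlinarith
  obtain ⟨N, hN, hNle, hNex⟩ := exists_ceIn_visitCorr_le hs hP k
  obtain ⟨N', hN', hNN', huniq, hex⟩ := hN.exists_uniformization
  obtain ⟨G, hG, hGopen⟩ := hV.exists_openSet_eq_stay hN'
  obtain ⟨F, hF, hFG⟩ := hG.exists_prefixFree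
  have hFopen (w : List (Fin D)) := (hFG w).2.trans (hGopen w)
  refine ⟨√(p * (k + 1) / k), F, Real.sqrt_nonneg _, ?_, hF, fun w => ⟨(hFG w).1, ?_, ?_, ?_⟩⟩
  · rw [Real.sqrt_lt' one_pos, one_pow, div_lt_one hk0]
    linarith
  · rw [hFopen]
    exact fun y hy => hy.1
  · by_cases hw : ∃ n, N' (w, n)
    · obtain ⟨n, hn⟩ := hw
      obtain ⟨hn0, hcorr⟩ := hNle w n (hNN' _ hn)
      refine (measureReal_mono ?_).trans (measureReal_segment_eq_inter_stay_le hmp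
        (Real.sqrt_nonneg _) ?_ (Nat.cast_pos.1 hk0) hn0 hcorr)
      · rw [hFopen]
        rintro y ⟨hy, n', hn', hall⟩
        exact ⟨hy, huniq w n' n hn' hn ▸ hall⟩
      · rw [Real.sq_sqrt (by positivity), div_mul_cancel₀ _ hk0.ne']
    · have hempty : openSet (fun u => F (w, u)) = ∅ := by
        rw [hFopen]
        exact Set.eq_empty_of_forall_notMem fun y ⟨_, n, hn, _⟩ => hw ⟨n, hn⟩
      rw [hempty, measureReal_empty]
      positivity
  · intro hw y hy hall
    obtain ⟨n, hn⟩ := hex w (hNex w hw)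
    rw [hFopen]
    exact ⟨hy, n, hn, fun i _ => hall i⟩

theorem IsOneRandomWith.exists_iterate_notMem (hx : IsOneRandomWith s P x)
    (hs : IsRepresentation s P) (hP : StationaryErgodic P) (hV : CEIn s V)
    (hO : (P : Measure (BiSeq D)).real (openSet V) < 1) : ∃ i, shift^[i] x ∉ openSet V := by
  obtain ⟨r, F, hr0, hr, hF, hrefine⟩ := exists_refinement hs hP hV hO
  by_contra! hstay
  let A (w : List (Fin D)) : Prop := w.length = 1
  have hA : CEIn s A := .of_primrecPred (Primrec.eq.comp Primrec.list_length (Primrec.const 1))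
  have hAfree : PrefixFree A := fun y k k' hk hk' => by
    simp only [A, length_segment] at hk hk'
    omega
  have hpos (k : ℕ) : 0 < blockProb P 1 (segment x k) := by
    rw [← measureReal_block_eq hP.toMeasurePreserving (-(k : ℤ)) (length_segment x k)]
    exact hx.measureReal_segment_eq_pos k
  have hreach (m : ℕ) : x ∈ openSet (ReachedIn A F m) := by
    induction m with
    | zero => exact ⟨0, length_segment x 0⟩
    | succ m ih =>
      obtain ⟨k, hk⟩ := ih
      obtain ⟨k', hk'⟩ := (hrefine (segment x k)).2.2.2 (hpos k) x
        (by rw [half_length_segment]) hstay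
      exact ⟨k', segment x k, hk, hk'⟩
  have hbound (m : ℕ) : (P : Measure (BiSeq D)).real (openSet (ReachedIn A F m)) ≤ 1 * r ^ m := by
    have hle := measure_openSet_reachedIn_le hAfree (fun w => (hrefine w).1)
      (fun w => (hrefine w).2.1) (μ := (P : Measure (BiSeq D))) (r := ENNReal.ofReal r)
      (fun w => by
        rw [← ofReal_measureReal, ← ofReal_measureReal, ← ENNReal.ofReal_mul hr0]
        exact ENNReal.ofReal_le_ofReal (hrefine w).2.2.1) m
    rw [one_mul, measureReal_def, ← ENNReal.toReal_ofReal (pow_nonneg hr0 m)]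
    refine ENNReal.toReal_mono ENNReal.ofReal_ne_top (hle.trans ?_)
    rw [ENNReal.ofReal_pow hr0]
    exact mul_le_of_le_one_right zero_le prob_le_one
  obtain ⟨m, hm⟩ := hx.exists_notMem_of_le_geometric (hA.reachedIn hF) hr0 hr hbound
  exact hm (hreach m)

theorem primrec_card_filter_range_mem :
    Primrec fun z : ℕ × List ℕ => ((Finset.range z.1).filter (· ∈ z.2)).card := by
  have hmem : PrimrecPred fun q : (ℕ × List ℕ) × ℕ => q.2 ∈ q.1.2 :=
    ((Primrec.eq (α := ℕ)).exists_mem_list.comp (Primrec.snd.comp Primrec.fst)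
      Primrec.snd).of_eq fun q => by simp
  refine (primrec_list_sum_nat.comp (Primrec.list_map (Primrec.list_range.comp Primrec.fst)
    (Primrec.ite hmem (Primrec.const 1) (Primrec.const 0)).to₂)).of_eq fun z => ?_
  rw [Finset.card_filter]
  rfl

open Classical in
theorem birkhoffSum_indicator_one {X : Type*} (T : X → X) (O : Set X) (n : ℕ) (y : X) :
    birkhoffSum T (O.indicator (1 : X → ℝ)) n y =
      ((Finset.range n).filter fun i => T^[i] y ∈ O).card := by
  simp only [birkhoffSum, Set.indicator_apply, Pi.one_apply, Finset.sum_boole]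

theorem CEIn.exists_openSet_eq_exists_lt_birkhoffSum (hV : CEIn s V) (A : ℕ) {B : ℕ} (hB : 0 < B) :
    ∃ G, CEIn s G ∧ openSet G =
      {y | ∃ n : ℕ, (A : ℝ) / B * n < birkhoffSum shift ((openSet V).indicator 1) n y} := by
  classical
  have hlt_iff (y : BiSeq D) (n : ℕ) :
      (A : ℝ) / B * n < birkhoffSum shift ((openSet V).indicator 1) n y ↔
        A * n < B * ((Finset.range n).filter fun i => shift^[i] y ∈ openSet V).card := by
    rw [birkhoffSum_indicator_one, div_mul_eq_mul_div, div_lt_iff₀' (by exact_mod_cast hB)]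
    exact_mod_cast Iff.rfl
  -- `z.2` is a list of positions of visits that `u` witnesses.
  refine ⟨fun u => ∃ z : ℕ × List ℕ,
      A * z.1 < B * ((Finset.range z.1).filter (· ∈ z.2)).card ∧ ∀ i ∈ z.2, Witnesses V u i,
    CEIn.ex (A := fun q : List (Fin D) × (ℕ × List ℕ) =>
      A * q.2.1 < B * ((Finset.range q.2.1).filter (· ∈ q.2.2)).card ∧
        ∀ i ∈ q.2.2, Witnesses V q.1 i) (.and ?_ ?_), Set.ext fun y => ?_⟩
  · exact .of_primrecPred (Primrec.nat_lt.comp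
      (Primrec.nat_mul.comp (Primrec.const A) (Primrec.fst.comp Primrec.snd))
      (Primrec.nat_mul.comp (Primrec.const B) (primrec_card_filter_range_mem.comp Primrec.snd)))
  · exact hV.witnesses.forall_mem.comp (Computable.fst.pair (Computable.snd.comp Computable.snd))
  simp only [Set.mem_ofPred_eq, hlt_iff]
  constructor
  · rintro ⟨k, ⟨n, l⟩, hlt, hwit⟩
    refine ⟨n, hlt.trans_le (Nat.mul_le_mul_left B (Finset.card_le_card ?_))⟩
    exact Finset.monotone_filter_right _ fun i _ hi => (hwit i hi).iterate_shift_mem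
  · rintro ⟨n, hn⟩
    let l := (List.range n).filter fun i => shift^[i] y ∈ openSet V
    have hl : ∀ᶠ k in atTop, ∀ i ∈ {i | i ∈ l}, Witnesses V (segment y k) i :=
      l.finite_toSet.eventually_all.2 fun i hi =>
        eventually_witnesses_segment (by simpa using (List.mem_filter.1 hi).2)
    obtain ⟨k, hk⟩ := hl.exists
    refine ⟨k, (n, l), hn.trans_le (Nat.mul_le_mul_left B (Finset.card_le_card fun i hi => ?_)), hk⟩
    simpa [l] using hi

theorem IsOneRandomWith.eventually_birkhoffSum_indicator_le (hx : IsOneRandomWith s P x)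
    (hs : IsRepresentation s P) (hP : StationaryErgodic P) (hV : CEIn s V) {q : ℝ}
    (hq : (P : Measure (BiSeq D)).real (openSet V) < q) :
    ∀ᶠ n : ℕ in atTop, birkhoffSum shift ((openSet V).indicator 1) n x ≤ q * n := by
  obtain ⟨A, B, hB, hA, hAq⟩ := exists_nat_div_btwn (measureReal_nonneg.trans_lt hq) hq
  obtain ⟨G, hG, hGopen⟩ := hV.exists_openSet_eq_exists_lt_birkhoffSum A hB
  obtain ⟨j, hj⟩ := hx.exists_iterate_notMem hs hP hG (hGopen ▸
    measureReal_exists_lt_birkhoffSum_indicator_lt_one hP.toMeasurePreserving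
      (measurableSet_openSet V) hA)
  rw [hGopen, Set.mem_ofPred_eq, not_exists] at hj
  have hnonneg (y : BiSeq D) : 0 ≤ (openSet V).indicator (1 : BiSeq D → ℝ) y :=
    Set.indicator_nonneg (fun _ _ => zero_le_one) y
  have hle_one (y : BiSeq D) : (openSet V).indicator (1 : BiSeq D → ℝ) y ≤ 1 :=
    Set.indicator_le_self' (fun _ _ => zero_le_one) y
  have hlim : Tendsto (fun n : ℕ => (q - A / B) * n) atTop atTop :=
    tendsto_natCast_atTop_atTop.const_mul_atTop (sub_pos.2 hAq)
  filter_upwards [hlim.eventually_ge_atTop (j : ℝ)] with n hn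
  calc birkhoffSum shift ((openSet V).indicator 1) n x
      ≤ birkhoffSum shift ((openSet V).indicator 1) (j + n) x :=
        Finset.sum_le_sum_of_subset_of_nonneg
          (Finset.range_subset_range.2 (Nat.le_add_left n j)) fun _ _ _ => hnonneg _
    _ = birkhoffSum shift ((openSet V).indicator 1) j x +
        birkhoffSum shift ((openSet V).indicator 1) n (shift^[j] x) := birkhoffSum_add ..
    _ ≤ j + A / B * n := by
        refine add_le_add ?_ (not_lt.1 (hj n))
        simpa [birkhoffSum] using Finset.sum_le_card_nsmul (Finset.range j) _ 1
          fun i _ => hle_one (shift^[i] x)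
    _ ≤ q * n := by linarith

end Escape

/-! ### Conditional probabilities of the next letter -/

section CondProb

variable {P : ProbabilityMeasure (BiSeq D)}

theorem block_length_append_singleton_iff (x : BiSeq D) (j : ℤ) (w : List (Fin D)) (a : Fin D) :
    block x j (w ++ [a]).length = w ++ [a] ↔ block x j w.length = w ∧ x (j + w.length) = a := by
  rw [List.length_append, List.length_singleton, block_succ]
  simp [List.append_singleton_inj]

theorem blockProb_append_singleton_le (j : ℤ) (w : List (Fin D)) (a : Fin D) :
    blockProb P j (w ++ [a]) ≤ blockProb P j w :=
  measureReal_mono fun x hx => ((block_length_append_singleton_iff x j w a).1 hx).1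

theorem condProb_nonneg (j : ℤ) (w : List (Fin D)) (a : Fin D) : 0 ≤ condProb P j w a :=
  div_nonneg (blockProb_nonneg P j _) (blockProb_nonneg P j w)

theorem condProb_le_one (j : ℤ) (w : List (Fin D)) (a : Fin D) : condProb P j w a ≤ 1 :=
  div_le_one_of_le₀ (blockProb_append_singleton_le j w a) (blockProb_nonneg P j w)

theorem condProb_eq_condProb_one (hP : MeasurePreserving shift (P : Measure (BiSeq D)) P)
    (j : ℤ) (w : List (Fin D)) (a : Fin D) : condProb P j w a = condProb P 1 w a :=
  congrArg₂ (· / ·) (measureReal_block_eq hP j rfl) (measureReal_block_eq hP j rfl)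

/-- The probability of the most probable letter after `w`. -/
noncomputable def maxCondProb (P : ProbabilityMeasure (BiSeq D)) (w : List (Fin D)) : ℝ :=
  ⨆ a : Fin D, condProb P 1 w a

theorem condProb_le_maxCondProb (w : List (Fin D)) (a : Fin D) :
    condProb P 1 w a ≤ maxCondProb P w :=
  le_ciSup (f := fun a => condProb P 1 w a) (Set.finite_range _).bddAbove a

theorem exists_condProb_eq_maxCondProb [NeZero D] (w : List (Fin D)) :
    ∃ a, condProb P 1 w a = maxCondProb P w := exists_eq_ciSup_of_finite

theorem maxCondProb_nonneg (w : List (Fin D)) : 0 ≤ maxCondProb P w :=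
  Real.iSup_nonneg fun a => condProb_nonneg 1 w a

theorem maxCondProb_le_one (w : List (Fin D)) : maxCondProb P w ≤ 1 :=
  Real.iSup_le (fun a => condProb_le_one 1 w a) zero_le_one

theorem ae_eq_condExp_indicator_comap {Ω ι : Type*} [MeasurableSpace Ω] [Countable ι]
    {μ : Measure Ω} [IsFiniteMeasure μ] {g : Ω → ι} (hg : ∀ A, MeasurableSet (g ⁻¹' A))
    {B : Set Ω} (hB : MeasurableSet B) :
    (fun ω => μ.real (g ⁻¹' {g ω} ∩ B) / μ.real (g ⁻¹' {g ω})) =ᵐ[μ]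
      μ[B.indicator 1 | MeasurableSpace.comap g ⊤] := by
  set φ : ι → ℝ := fun v => μ.real (g ⁻¹' {v} ∩ B) / μ.real (g ⁻¹' {v})
  change (fun ω => φ (g ω)) =ᵐ[μ] _
  have hle : MeasurableSpace.comap g ⊤ ≤ ‹MeasurableSpace Ω› := by
    rintro _ ⟨A, -, rfl⟩
    exact hg A
  have hmeas : Measurable[MeasurableSpace.comap g ⊤] fun ω => φ (g ω) :=
    fun A _ => ⟨φ ⁻¹' A, trivial, rfl⟩
  have hindInt : Integrable (B.indicator (1 : Ω → ℝ)) μ := (integrable_const 1).indicator hB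
  have hint : Integrable (fun ω => φ (g ω)) μ := by
    refine Integrable.of_bound (hmeas.mono hle le_rfl).aestronglyMeasurable 1
      (ae_of_all _ fun ω => ?_)
    rw [Real.norm_of_nonneg (div_nonneg measureReal_nonneg measureReal_nonneg)]
    exact div_le_one_of_le₀ (measureReal_mono Set.inter_subset_left) measureReal_nonneg
  refine ae_eq_condExp_of_forall_setIntegral_eq hle hindInt (fun _ _ _ => hint.integrableOn) ?_
    hmeas.stronglyMeasurable.aestronglyMeasurable
  rintro _ ⟨A, -, rfl⟩ -
  have hfibres : g ⁻¹' A = ⋃ v : A, g ⁻¹' {v.1} := by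
    ext ω
    simp
  have hdisj : Pairwise (Function.onFun Disjoint fun v : A => g ⁻¹' {v.1}) :=
    fun v v' hv => (Set.disjoint_singleton.2 (Subtype.coe_injective.ne hv)).preimage g
  rw [hfibres, integral_iUnion (fun v => hg _) hdisj hint.integrableOn,
    integral_iUnion (fun v => hg _) hdisj hindInt.integrableOn]
  refine tsum_congr fun v => ?_
  rw [setIntegral_congr_fun (g := fun _ => φ v) (hg {v.1}) (fun ω (hω : g ω = v) => congrArg φ hω),
    setIntegral_const, setIntegral_indicator hB, Pi.one_def, setIntegral_const, smul_eq_mul,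
    smul_eq_mul, mul_one]
  rcases eq_or_ne (μ.real (g ⁻¹' {v.1})) 0 with hv | hv
  · rw [hv, zero_mul]
    exact (measureReal_mono_null Set.inter_subset_left hv).symm
  · exact mul_div_cancel₀ _ hv

/-- The σ-fields generated by the past letters `x_{-n}, ..., x_{-1}`. -/
def pastFiltration (D : ℕ) : Filtration ℕ (inferInstance : MeasurableSpace (BiSeq D)) where
  seq n := MeasurableSpace.comap (fun x : BiSeq D => block x (-(n : ℤ)) n) ⊤
  mono' := by
    refine monotone_nat_of_le_succ fun n => ?_
    rintro _ ⟨A, -, rfl⟩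
    refine ⟨(List.drop 1 · |>.take n) ⁻¹' A, trivial, ?_⟩
    ext x
    simp only [Set.mem_preimage, take_drop_block x _ (Nat.add_comm 1 n).le]
    congr! 2
    push_cast
    ring
  le' n := by
    rintro _ ⟨A, -, rfl⟩
    exact measurableSet_block_mem _ _ A

theorem condProb_ae_eq_condExp (n : ℕ) (a : Fin D) :
    (fun x => condProb P (-(n : ℤ)) (block x (-(n : ℤ)) n) a) =ᵐ[(P : Measure (BiSeq D))]
      (P : Measure (BiSeq D))[{x : BiSeq D | x 0 = a}.indicator 1 | pastFiltration D n] := by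
  have hletter : MeasurableSet {x : BiSeq D | x 0 = a} :=
    measurableSet_eq_fun (measurable_pi_apply 0) measurable_const
  refine (EventuallyEq.of_eq (funext fun x => ?_)).trans (ae_eq_condExp_indicator_comap
    (g := fun x : BiSeq D => block x (-(n : ℤ)) n) (measurableSet_block_mem _ n) hletter)
  rw [condProb, blockProb, blockProb, length_block]
  congr 2
  ext y
  have hiff := block_length_append_singleton_iff y (-(n : ℤ)) (block x (-(n : ℤ)) n) a
  rwa [length_block, neg_add_cancel] at hiff

theorem exists_measurable_tendsto_maxCondProb [NeZero D]
    (hP : MeasurePreserving shift (P : Measure (BiSeq D)) P) :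
    ∃ G : BiSeq D → ℝ, Measurable G ∧ ∀ᵐ x ∂(P : Measure (BiSeq D)),
      Tendsto (fun n : ℕ => maxCondProb P (block x (-(n : ℤ)) n)) atTop (𝓝 (G x)) := by
  let φ (a : Fin D) : BiSeq D → ℝ :=
    (P : Measure (BiSeq D))[{x : BiSeq D | x 0 = a}.indicator 1 | ⨆ n, pastFiltration D n]
  refine ⟨fun x => ⨆ a, φ a x, Measurable.iSup fun a => (stronglyMeasurable_condExp.mono
    (iSup_le fun n => (pastFiltration D).le n)).measurable, ?_⟩
  have hletter (a : Fin D) : ∀ᵐ x ∂(P : Measure (BiSeq D)), Tendsto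
      (fun n : ℕ => condProb P 1 (block x (-(n : ℤ)) n) a) atTop (𝓝 (φ a x)) := by
    filter_upwards [ae_all_iff.2 fun n => condProb_ae_eq_condExp (P := P) n a, tendsto_ae_condExp
      (ℱ := pastFiltration D) ({x : BiSeq D | x 0 = a}.indicator 1)] with x hx hlim
    refine hlim.congr fun n => ?_
    rw [← hx n, condProb_eq_condProb_one hP]
  filter_upwards [ae_all_iff.2 hletter] with x hx
  have hmax := Tendsto.finset_sup'_nhds_apply (s := (Finset.univ : Finset (Fin D)))
    Finset.univ_nonempty fun a _ => hx a
  simpa only [maxCondProb, Finset.sup'_univ_eq_ciSup] using hmax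

end CondProb

/-! ### Averages of functions of the past along random orbits -/

section LayerCake

theorem mul_le_one_add_card_filter_lt {t : ℝ} (ht : t ≤ 1) (M : ℕ) :
    M * t ≤ 1 + ((Finset.range M).filter fun j : ℕ => ((j + 1 : ℕ) : ℝ) < M * t).card := by
  have hsub : Finset.range (⌈M * t⌉₊ - 1) ⊆
      (Finset.range M).filter fun j : ℕ => ((j + 1 : ℕ) : ℝ) < M * t := by
    intro j hj
    have hlt : ((j + 1 : ℕ) : ℝ) < M * t := Nat.lt_ceil.1 (by have := Finset.mem_range.1 hj; omega)
    refine Finset.mem_filter.2 ⟨Finset.mem_range.2 (Nat.succ_le_iff.1 ?_), hlt⟩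
    exact_mod_cast hlt.le.trans (mul_le_of_le_one_right M.cast_nonneg ht)
  have hcard := Finset.card_le_card hsub
  rw [Finset.card_range, Nat.sub_le_iff_le_add'] at hcard
  exact (Nat.le_ceil _).trans (by exact_mod_cast hcard)

theorem mul_sum_le_card_add_sum_card_filter {ι : Type*} (I : Finset ι) {a : ι → ℝ}
    (ha : ∀ i ∈ I, a i ≤ 1) (M : ℕ) :
    M * ∑ i ∈ I, a i ≤ I.card +
      ∑ j ∈ Finset.range M, ((I.filter fun i => ((j + 1 : ℕ) : ℝ) < M * a i).card : ℝ) := by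
  calc M * ∑ i ∈ I, a i
      ≤ ∑ i ∈ I,
          (1 + (((Finset.range M).filter fun j : ℕ => ((j + 1 : ℕ) : ℝ) < M * a i).card : ℝ)) := by
        rw [Finset.mul_sum]
        exact Finset.sum_le_sum fun i hi => mul_le_one_add_card_filter_lt (ha i hi) M
    _ = _ := by
        simp only [← Finset.sum_boole, Finset.sum_add_distrib]
        rw [Finset.sum_comm]
        simp

theorem card_filter_le_le_mul {t : ℝ} (ht : 0 ≤ t) (M : ℕ) :
    (((Finset.range M).filter fun j : ℕ => ((j + 1 : ℕ) : ℝ) ≤ M * t).card : ℝ) ≤ M * t := by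
  have hsub : ((Finset.range M).filter fun j : ℕ => ((j + 1 : ℕ) : ℝ) ≤ M * t) ⊆
      Finset.range ⌊M * t⌋₊ := fun j hj =>
    Finset.mem_range.2 (Nat.succ_le_iff.1 (Nat.le_floor (Finset.mem_filter.1 hj).2))
  have hcard := Finset.card_le_card hsub
  rw [Finset.card_range] at hcard
  exact (Nat.cast_le.2 hcard).trans (Nat.floor_le (by positivity))

variable {Ω : Type*} [MeasurableSpace Ω] {μ : Measure Ω} [IsFiniteMeasure μ]

theorem sum_measureReal_le_mul_integral {H : Ω → ℝ} (hH : Measurable H) (hint : Integrable H μ)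
    (hH0 : 0 ≤ᵐ[μ] H) (M : ℕ) :
    ∑ j ∈ Finset.range M, μ.real {ω | ((j + 1 : ℕ) : ℝ) ≤ M * H ω} ≤ M * ∫ ω, H ω ∂μ := by
  have hmeas (j : ℕ) : MeasurableSet {ω | ((j + 1 : ℕ) : ℝ) ≤ M * H ω} :=
    measurableSet_le measurable_const (hH.const_mul _)
  have hindInt (j : ℕ) :
      Integrable ({ω | ((j + 1 : ℕ) : ℝ) ≤ M * H ω}.indicator (1 : Ω → ℝ)) μ :=
    (integrable_const 1).indicator (hmeas j)
  calc ∑ j ∈ Finset.range M, μ.real {ω | ((j + 1 : ℕ) : ℝ) ≤ M * H ω}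
      = ∫ ω, ∑ j ∈ Finset.range M,
          {ω | ((j + 1 : ℕ) : ℝ) ≤ M * H ω}.indicator (1 : Ω → ℝ) ω ∂μ := by
        rw [integral_finsetSum _ fun j _ => hindInt j]
        exact Finset.sum_congr rfl fun j _ => (integral_indicator_one (hmeas j)).symm
    _ ≤ ∫ ω, M * H ω ∂μ := by
        refine integral_mono_ae (integrable_finsetSum _ fun j _ => hindInt j)
          (hint.const_mul _) ?_
        filter_upwards [hH0] with ω hω
        classical
        simpa only [Set.indicator_apply, Set.mem_ofPred_eq, Pi.one_apply, Finset.sum_boole]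
          using card_filter_le_le_mul hω M
    _ = M * ∫ ω, H ω ∂μ := integral_const_mul _ _

theorem exists_measureReal_exists_ge_lt {S : ℕ → Set Ω} (hS : ∀ n, MeasurableSet (S n)) {q : ℝ}
    (hq : μ.real {ω | ∃ᶠ n in atTop, ω ∈ S n} < q) :
    ∃ k, μ.real {ω | ∃ n ≥ k, ω ∈ S n} < q := by
  have hlim : Tendsto (fun k => μ {ω | ∃ n ≥ k, ω ∈ S n}) atTop
      (𝓝 (μ {ω | ∃ᶠ n in atTop, ω ∈ S n})) := by
    have hinter : {ω | ∃ᶠ n in atTop, ω ∈ S n} = ⋂ k, {ω | ∃ n ≥ k, ω ∈ S n} := by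
      ext ω
      simp [frequently_atTop]
    rw [hinter]
    refine tendsto_measure_iInter_atTop (fun k => ?_)
      (fun k k' hk ω ⟨n, hn, hω⟩ => ⟨n, hk.trans hn, hω⟩) ⟨0, measure_ne_top _ _⟩
    simp only [Set.ofPred_exists, Set.ofPred_and]
    exact (MeasurableSet.iUnion fun n =>
      (MeasurableSet.const _).inter (hS n)).nullMeasurableSet
  exact (((ENNReal.tendsto_toReal (measure_ne_top _ _)).comp hlim).eventually_lt_const hq).exists

end LayerCake

section Breiman

variable {s x : BiSeq D} {P : ProbabilityMeasure (BiSeq D)}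

theorem CEIn.exists_openSet_eq_exists_ge {Z : List (Fin D) → Prop} (hZ : CEIn s Z) {j : ℕ → ℤ}
    {o : ℕ → ℕ → ℕ} (ho : Primrec₂ o) (hle : ∀ k n, n ≤ k → o k n + n ≤ 2 * k + 1)
    (hj : ∀ k n, n ≤ k → (o k n : ℤ) = j n + k) :
    ∃ V : ℕ × List (Fin D) → Prop, CEIn s V ∧
      ∀ m, openSet (fun u => V (m, u)) = {y | ∃ n ≥ m, Z (block y (j n) n)} := by
  let window (q : List (Fin D) × ℕ) : List (Fin D) :=
    (q.1.drop (o (q.1.length / 2) q.2)).take q.2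
  have hhalf : Primrec fun q : List (Fin D) × ℕ => q.1.length / 2 :=
    Primrec.nat_div.comp (Primrec.list_length.comp .fst) (.const 2)
  have hwindow : Primrec window :=
    Primrec.list_take.comp .snd (Primrec.list_drop.comp (ho.comp hhalf .snd) .fst)
  have hwindow_segment (y : BiSeq D) {n k : ℕ} (hnk : n ≤ k) :
      window (segment y k, n) = block y (j n) n := by
    simp only [window, half_length_segment]
    rw [segment, take_drop_block y _ (hle k n hnk), hj k n hnk, add_comm (j n), neg_add_cancel_left]
  have harg : Primrec fun z : (ℕ × List (Fin D)) × ℕ => (z.1.2, z.2) :=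
    (Primrec.snd.comp .fst).pair .snd
  refine ⟨fun q => ∃ n, (q.1 ≤ n ∧ n ≤ q.2.length / 2) ∧ Z (window (q.2, n)),
    CEIn.ex (A := fun z : (ℕ × List (Fin D)) × ℕ =>
      (z.1.1 ≤ z.2 ∧ z.2 ≤ z.1.2.length / 2) ∧ Z (window (z.1.2, z.2)))
      (.and (.of_primrecPred ((Primrec.nat_le.comp (Primrec.fst.comp .fst) .snd).and
        (Primrec.nat_le.comp .snd (hhalf.comp harg)))) (hZ.comp (hwindow.comp harg).to_comp)),
    fun m => Set.ext fun y => ?_⟩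
  simp only [openSet, Set.mem_ofPred_eq, half_length_segment]
  constructor
  · rintro ⟨k, n, ⟨hm, hk⟩, hn⟩
    exact ⟨n, hm, hwindow_segment y hk ▸ hn⟩
  · rintro ⟨n, hm, hn⟩
    exact ⟨n, n, ⟨hm, le_rfl⟩, (hwindow_segment y le_rfl).symm ▸ hn⟩

theorem card_filter_range_le_add_card_filter_range_succ {p p' : ℕ → Prop} [DecidablePred p]
    [DecidablePred p'] {k : ℕ} (h : ∀ i, k ≤ i → p i → p' (i + 1)) (n : ℕ) :
    ((Finset.range n).filter p).card ≤ k + ((Finset.range (n + 1)).filter p').card := by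
  have hsub : (Finset.range n).filter p ⊆
      Finset.range k ∪ (Finset.range n).filter fun i => p' (i + 1) := by
    intro i hi
    obtain ⟨hin, hpi⟩ := Finset.mem_filter.1 hi
    rcases lt_or_ge i k with hik | hik
    · exact Finset.mem_union_left _ (Finset.mem_range.2 hik)
    · exact Finset.mem_union_right _ (Finset.mem_filter.2 ⟨hin, h i hik hpi⟩)
  have hsucc : ((Finset.range n).filter fun i => p' (i + 1)).card ≤
      ((Finset.range (n + 1)).filter p').card :=
    Finset.card_le_card_of_injOn (· + 1) (fun i hi => by simpa using hi)
      (add_left_injective 1).injOn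
  refine (Finset.card_le_card hsub).trans ((Finset.card_union_le _ _).trans ?_)
  rw [Finset.card_range]
  gcongr

open Classical in
theorem IsOneRandomWith.eventually_card_filter_block_le (hx : IsOneRandomWith s P x)
    (hs : IsRepresentation s P) (hP : StationaryErgodic P) {Z : List (Fin D) → Prop}
    (hZ : CEIn s Z) {q : ℝ}
    (hq : (P : Measure (BiSeq D)).real {y | ∃ᶠ n : ℕ in atTop, Z (block y (-(n : ℤ)) n)} < q) :
    ∀ᶠ n : ℕ in atTop, ((Finset.range n).filter fun i => Z (block x 1 i)).card ≤ q * n := by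
  obtain ⟨q', hq', hq'q⟩ := exists_between hq
  obtain ⟨k, hk⟩ := exists_measureReal_exists_ge_lt
    (S := fun n : ℕ => {y : BiSeq D | Z (block y (-(n : ℤ)) n)})
    (fun n => measurableSet_block_mem _ n {w | Z w}) hq'
  obtain ⟨W, hW, hWopen⟩ := hZ.exists_openSet_eq_exists_ge (j := fun n => -(n : ℤ))
    (o := fun k n => k - n) Primrec.nat_sub (by omega) (by omega)
  let V (u : List (Fin D)) : Prop := W (k, u)
  have hV : CEIn s V := hW.comp ((Computable.const k).pair .id)
  have hVopen : openSet V = {y | ∃ n ≥ k, Z (block y (-(n : ℤ)) n)} := hWopen k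
  have hfreq := hx.eventually_birkhoffSum_indicator_le hs hP hV (hVopen ▸ hk)
  have hvisit {i : ℕ} (hi : k ≤ i) (hZi : Z (block x 1 i)) : shift^[i + 1] x ∈ openSet V := by
    rw [hVopen]
    refine ⟨i, hi, ?_⟩
    rw [block_iterate_shift]
    push_cast
    rwa [neg_add_cancel_left]
  have hlim : Tendsto (fun n : ℕ => (q - q') * n) atTop atTop :=
    tendsto_natCast_atTop_atTop.const_mul_atTop (sub_pos.2 hq'q)
  filter_upwards [(tendsto_add_atTop_nat 1).eventually hfreq,
    hlim.eventually_ge_atTop (k + q' : ℝ)] with n hn hkn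
  rw [birkhoffSum_indicator_one] at hn
  have hcard' : (((Finset.range n).filter fun i => Z (block x 1 i)).card : ℝ) ≤
      k + ((Finset.range (n + 1)).filter fun i => shift^[i] x ∈ openSet V).card := by
    exact_mod_cast card_filter_range_le_add_card_filter_range_succ
      (p' := fun i => shift^[i] x ∈ openSet V) (fun i => hvisit) n
  push_cast at hn
  linarith

theorem ae_blockProb_past_pos (hP : MeasurePreserving shift (P : Measure (BiSeq D)) P) :
    ∀ᵐ y ∂(P : Measure (BiSeq D)), ∀ n : ℕ, 0 < blockProb P 1 (block y (-(n : ℤ)) n) := by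
  refine ae_all_iff.2 fun n => ae_iff.2 (measure_mono_null (t := ⋃ w ∈ {w : List (Fin D) |
    w.length = n ∧ blockProb P 1 w = 0}, {y | block y (-(n : ℤ)) n = w}) (fun y hy => ?_)
    ((measure_biUnion_null_iff (Set.to_countable _)).2 fun w hw => ?_))
  · exact Set.mem_biUnion (x := block y (-(n : ℤ)) n)
      ⟨length_block y _ n, (not_lt.1 hy).antisymm (blockProb_nonneg P 1 _)⟩ rfl
  · exact (measureReal_eq_zero_iff).1 ((measureReal_block_eq hP _ hw.1).trans hw.2)

theorem measureReal_frequently_past_le {Z : List (Fin D) → Prop} {h : List (Fin D) → ℝ}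
    {H : BiSeq D → ℝ} {t : ℝ} (hP : MeasurePreserving shift (P : Measure (BiSeq D)) P)
    (hZ : ∀ w, 0 < blockProb P 1 w → Z w → t ≤ h w)
    (hlim : ∀ᵐ y ∂(P : Measure (BiSeq D)),
      Tendsto (fun n : ℕ => h (block y (-(n : ℤ)) n)) atTop (𝓝 (H y))) :
    (P : Measure (BiSeq D)).real {y | ∃ᶠ n : ℕ in atTop, Z (block y (-(n : ℤ)) n)} ≤
      (P : Measure (BiSeq D)).real {y | t ≤ H y} := by
  refine ENNReal.toReal_mono (measure_ne_top _ _) (measure_mono_ae ?_)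
  filter_upwards [hlim, ae_blockProb_past_pos hP] with y hy hpos hfreq
  exact ge_of_tendsto_of_frequently hy (hfreq.mono fun n hn => hZ _ (hpos n) hn)

theorem IsOneRandomWith.eventually_sum_past_le (hx : IsOneRandomWith s P x)
    (hs : IsRepresentation s P) (hP : StationaryErgodic P) {h : List (Fin D) → ℝ}
    (h0 : ∀ w, 0 ≤ h w) (h1 : ∀ w, h w ≤ 1)
    (hZ : ∀ j M : ℕ, ∃ Z : List (Fin D) → Prop, CEIn s Z ∧
      ∀ w, 0 < blockProb P 1 w → (Z w ↔ (j : ℝ) < M * h w))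
    {H : BiSeq D → ℝ} (hH : Measurable H)
    (hlim : ∀ᵐ y ∂(P : Measure (BiSeq D)),
      Tendsto (fun n : ℕ => h (block y (-(n : ℤ)) n)) atTop (𝓝 (H y)))
    {ε : ℝ} (hε : 0 < ε) :
    ∀ᶠ n : ℕ in atTop, ∑ i ∈ Finset.range n, h (block x 1 i) ≤
      ((∫ y, H y ∂(P : Measure (BiSeq D))) + ε) * n := by
  classical
  set μ : Measure (BiSeq D) := (P : Measure (BiSeq D))
  have hH0 : 0 ≤ᵐ[μ] H := hlim.mono fun y hy => ge_of_tendsto' hy fun n => h0 _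
  have hint : Integrable H μ := by
    refine .of_bound hH.aestronglyMeasurable 1 ?_
    filter_upwards [hlim, hH0] with y hy hy0
    exact (Real.norm_of_nonneg hy0).trans_le (le_of_tendsto' hy fun n => h1 _)
  obtain ⟨M, hM⟩ := exists_nat_gt (2 / ε)
  have hM0 : (0 : ℝ) < M := (by positivity : 0 < 2 / ε).trans hM
  choose Z hZce hZiff using fun j : ℕ => hZ (j + 1) M
  have hfreq (j : ℕ) : μ.real {y | ∃ᶠ n : ℕ in atTop, Z j (block y (-(n : ℤ)) n)} <
      μ.real {y | ((j + 1 : ℕ) : ℝ) ≤ M * H y} + ε / 2 :=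
    (measureReal_frequently_past_le hP.toMeasurePreserving (h := fun w => M * h w)
      (fun w hw hZw => ((hZiff j w hw).1 hZw).le)
      (hlim.mono fun y hy => hy.const_mul _)).trans_lt (lt_add_of_pos_right _ (half_pos hε))
  have hcount : ∀ᶠ n : ℕ in atTop, ∀ j ∈ Finset.range M,
      (((Finset.range n).filter fun i => Z j (block x 1 i)).card : ℝ) ≤
        (μ.real {y | ((j + 1 : ℕ) : ℝ) ≤ M * H y} + ε / 2) * n :=
    (Finset.eventually_all _).2 fun j _ =>
      hx.eventually_card_filter_block_le hs hP (hZce j) (hfreq j)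
  filter_upwards [hcount] with n hn
  refine le_of_mul_le_mul_left ?_ hM0
  calc M * ∑ i ∈ Finset.range n, h (block x 1 i)
      ≤ n + ∑ j ∈ Finset.range M,
          (((Finset.range n).filter fun i => Z j (block x 1 i)).card : ℝ) := by
        simpa only [hZiff _ _ (hx.blockProb_pos _), Finset.card_range] using
          mul_sum_le_card_add_sum_card_filter (Finset.range n) (fun i _ => h1 (block x 1 i)) M
    _ ≤ n + ∑ j ∈ Finset.range M, (μ.real {y | ((j + 1 : ℕ) : ℝ) ≤ M * H y} + ε / 2) * n := by
        gcongr with j hj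
        exact hn j hj
    _ ≤ n + (M * ∫ y, H y ∂μ + M * (ε / 2)) * n := by
        rw [← Finset.sum_mul, Finset.sum_add_distrib, Finset.sum_const, Finset.card_range,
          nsmul_eq_mul]
        gcongr
        exact sum_measureReal_le_mul_integral hH hint hH0 M
    _ ≤ M * (((∫ y, H y ∂μ) + ε) * n) := by
        have : 1 * (n : ℝ) ≤ M * (ε / 2) * n := by
          gcongr
          rw [div_lt_iff₀ hε] at hM
          linarith
        linarith

theorem CEIn.forall_fin {α : Type*} [Primcodable α] {A : α × Fin D → Prop} (hA : CEIn s A) :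
    CEIn s fun a => ∀ i, A (a, i) :=
  (hA.forall_mem.comp (f := fun a : α => (a, List.finRange D))
    (Computable.id.pair (Computable.const _))).of_iff fun a => by simp

theorem exists_ceIn_lt_maxCondProb [NeZero D] (hs : IsRepresentation s P) (j M : ℕ) :
    ∃ Z : List (Fin D) → Prop, CEIn s Z ∧
      ∀ w, 0 < blockProb P 1 w → (Z w ↔ (j : ℝ) < M * maxCondProb P w) := by
  refine ⟨fun w => ∃ a, (j : ℝ) * blockProb P 1 w < M * blockProb P 1 (w ++ [a]), ?_,
    fun w hw => ?_⟩
  · refine CEIn.ex (A := fun z : List (Fin D) × Fin D =>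
      (j : ℝ) * blockProb P 1 z.1 < M * blockProb P 1 (z.1 ++ [z.2])) ?_
    simpa only [List.map_singleton, List.sum_singleton] using hs.ceIn_mul_sum_blockProb_lt
      (Computable.const j) (L := fun z : List (Fin D) × Fin D => [z.1])
      (Primrec.list_cons.comp .fst (.const [])).to_comp (Computable.const M)
      (L' := fun z => [z.1 ++ [z.2]])
      (Primrec.list_cons.comp (Primrec.list_concat.comp .fst .snd) (.const [])).to_comp
  · have hcond (a : Fin D) : (j : ℝ) * blockProb P 1 w < M * blockProb P 1 (w ++ [a]) ↔
        (j : ℝ) < M * condProb P 1 w a := by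
      rw [condProb, ← mul_div_assoc, lt_div_iff₀ hw]
    simp only [hcond]
    constructor
    · rintro ⟨a, ha⟩
      exact ha.trans_le (by gcongr; exact condProb_le_maxCondProb w a)
    · intro hlt
      obtain ⟨a, ha⟩ := exists_condProb_eq_maxCondProb (P := P) w
      exact ⟨a, ha ▸ hlt⟩

theorem exists_ceIn_lt_one_sub_maxCondProb [NeZero D] (hs : IsRepresentation s P) (j M : ℕ) :
    ∃ Z : List (Fin D) → Prop, CEIn s Z ∧
      ∀ w, 0 < blockProb P 1 w → (Z w ↔ (j : ℝ) < M * (1 - maxCondProb P w)) := by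
  refine ⟨fun w => ∀ a, (M : ℝ) * blockProb P 1 (w ++ [a]) < ((M - j : ℕ) : ℝ) * blockProb P 1 w,
    ?_, fun w hw => ?_⟩
  · refine CEIn.forall_fin (A := fun z : List (Fin D) × Fin D =>
      (M : ℝ) * blockProb P 1 (z.1 ++ [z.2]) < ((M - j : ℕ) : ℝ) * blockProb P 1 z.1) ?_
    simpa only [List.map_singleton, List.sum_singleton] using hs.ceIn_mul_sum_blockProb_lt
      (Computable.const M) (L := fun z : List (Fin D) × Fin D => [z.1 ++ [z.2]])
      (Primrec.list_cons.comp (Primrec.list_concat.comp .fst .snd) (.const [])).to_comp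
      (Computable.const (M - j)) (L' := fun z => [z.1])
      (Primrec.list_cons.comp .fst (.const [])).to_comp
  · have hcond (a : Fin D) :
        (M : ℝ) * blockProb P 1 (w ++ [a]) < ((M - j : ℕ) : ℝ) * blockProb P 1 w ↔
          M * condProb P 1 w a < ((M - j : ℕ) : ℝ) := by
      rw [condProb, ← mul_div_assoc, div_lt_iff₀ hw]
    obtain ⟨b, hb⟩ := exists_condProb_eq_maxCondProb (P := P) w
    have hmax : (∀ a, M * condProb P 1 w a < ((M - j : ℕ) : ℝ)) ↔
        M * maxCondProb P w < ((M - j : ℕ) : ℝ) :=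
      ⟨fun h => hb ▸ h b, fun h a => lt_of_le_of_lt
        (by gcongr; exact condProb_le_maxCondProb w a) h⟩
    simp only [hcond, hmax]
    rcases le_total j M with hj | hj
    · rw [Nat.cast_sub hj]
      constructor <;> intro h <;> linarith
    · have hnonneg := mul_nonneg M.cast_nonneg (maxCondProb_nonneg (P := P) w)
      rw [Nat.sub_eq_zero_of_le hj, Nat.cast_zero, mul_one_sub]
      have hj' : (M : ℝ) ≤ j := by exact_mod_cast hj
      constructor <;> intro h <;> linarith

theorem IsOneRandomWith.tendsto_average_maxCondProb [NeZero D] (hx : IsOneRandomWith s P x)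
    (hs : IsRepresentation s P) (hP : StationaryErgodic P) {G : BiSeq D → ℝ} (hG : Measurable G)
    (hlim : ∀ᵐ y ∂(P : Measure (BiSeq D)),
      Tendsto (fun n : ℕ => maxCondProb P (block y (-(n : ℤ)) n)) atTop (𝓝 (G y))) :
    Tendsto (fun n : ℕ => (1 / (n : ℝ)) * ∑ i ∈ Finset.range n, maxCondProb P (block x 1 i)) atTop
      (𝓝 (∫ y, G y ∂(P : Measure (BiSeq D)))) := by
  have hGint : Integrable G (P : Measure (BiSeq D)) := by
    refine .of_bound hG.aestronglyMeasurable 1 (hlim.mono fun y hy => ?_)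
    rw [Real.norm_of_nonneg (ge_of_tendsto' hy fun n => maxCondProb_nonneg _)]
    exact le_of_tendsto' hy fun n => maxCondProb_le_one _
  rw [Metric.tendsto_nhds]
  intro ε hε
  have hupper := hx.eventually_sum_past_le hs hP (h := maxCondProb P) maxCondProb_nonneg
    maxCondProb_le_one (exists_ceIn_lt_maxCondProb hs) hG hlim (half_pos hε)
  have hlower := hx.eventually_sum_past_le hs hP (h := fun w => 1 - maxCondProb P w)
    (H := fun y => 1 - G y) (fun w => sub_nonneg.2 (maxCondProb_le_one w))
    (fun w => sub_le_self _ (maxCondProb_nonneg w))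
    (exists_ceIn_lt_one_sub_maxCondProb hs) (hG.const_sub 1)
    (hlim.mono fun y hy => hy.const_sub 1) (half_pos hε)
  filter_upwards [hupper, hlower, eventually_gt_atTop 0] with n hle hge hn
  have hn' : (0 : ℝ) < n := by exact_mod_cast hn
  rw [integral_sub (integrable_const 1) hGint] at hge
  simp only [integral_const, probReal_univ, one_smul, Finset.sum_sub_distrib, Finset.sum_const,
    Finset.card_range, nsmul_eq_mul, mul_one] at hge
  have hεn : 0 < ε * n := mul_pos hε hn'
  rw [Real.dist_eq, one_div_mul_eq_div, abs_lt, lt_sub_iff_add_lt, lt_div_iff₀ hn',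
    sub_lt_iff_lt_add, div_lt_iff₀ hn']
  constructor <;> linarith

end Breiman

/-! ### Martingale differences along random points -/

section Azuma

open ProbabilityTheory

variable {Ω : Type*} {m mΩ : MeasurableSpace Ω} [StandardBorelSpace Ω] {μ : Measure Ω}
  [IsProbabilityMeasure μ]

theorem hasCondSubgaussianMGF_of_mem_Icc_of_condExp_eq_zero (hm : m ≤ mΩ) {X : Ω → ℝ}
    (hX : Measurable X) {a b : ℝ} (hab : ∀ ω, X ω ∈ Set.Icc a b) (hcond : μ[X | m] =ᵐ[μ] 0) :
    HasCondSubgaussianMGF m hm X ((‖b - a‖₊ / 2) ^ 2) μ := by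
  have hint : Integrable X μ := .of_mem_Icc a b hX.aemeasurable (ae_of_all μ hab)
  have hcond_trim : μ[X | m] =ᵐ[μ.trim hm] 0 :=
    StronglyMeasurable.ae_eq_trim_of_stronglyMeasurable hm stronglyMeasurable_condExp
      stronglyMeasurable_zero hcond
  refine ⟨fun t => ?_, ?_⟩
  · rw [condExpKernel_comp_trim hm]
    exact integrable_exp_mul_of_mem_Icc hX.aemeasurable (ae_of_all μ hab)
  · filter_upwards [condExp_ae_eq_trim_integral_condExpKernel hm hint, hcond_trim] with ω hω hω0
    exact (hasSubgaussianMGF_of_mem_Icc_of_integral_eq_zero hX.aemeasurable (ae_of_all _ hab)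
      (hω.symm.trans hω0)).mgf_le

theorem measureReal_le_sum_le_exp {ℱ : Filtration ℕ mΩ} {Y : ℕ → Ω → ℝ}
    (hmeas : ∀ i, Measurable[ℱ (i + 1)] (Y i)) (hY : ∀ i ω, Y i ω ∈ Set.Icc (-1) 1)
    (hcond : ∀ i, μ[Y i | ℱ i] =ᵐ[μ] 0) {ε : ℝ} (hε : 0 ≤ ε) (n : ℕ) :
    μ.real {ω | ε * n ≤ ∑ i ∈ Finset.range n, Y i ω} ≤ Real.exp (-ε ^ 2 / 2) ^ n := by
  have hone : ((‖(1 : ℝ) - -1‖₊ / 2) ^ 2 : NNReal) = 1 := by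
    ext
    norm_num
  have hmeas' (i : ℕ) : Measurable (Y i) := (hmeas i).mono (ℱ.le _) le_rfl
  let 𝒢 : Filtration ℕ mΩ := ⟨fun i => ℱ (i + 1), fun _ _ h => ℱ.mono (by omega), fun i => ℱ.le _⟩
  have h0 : HasSubgaussianMGF (Y 0) 1 μ := by
    rw [← hone]
    refine hasSubgaussianMGF_of_mem_Icc_of_integral_eq_zero (hmeas' 0).aemeasurable
      (ae_of_all μ (hY 0)) ?_
    rw [← integral_condExp (ℱ.le 0), integral_congr_ae (hcond 0)]
    simp
  have hsucc (i : ℕ) : HasCondSubgaussianMGF (𝒢 i) (𝒢.le i) (Y (i + 1)) 1 μ := hone ▸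
    hasCondSubgaussianMGF_of_mem_Icc_of_condExp_eq_zero (𝒢.le i) (hmeas' _) (hY _) (hcond _)
  have hazuma := measure_sum_ge_le_of_hasCondSubgaussianMGF (ℱ := 𝒢) (cY := fun _ => 1)
    (fun i => (hmeas i).stronglyMeasurable) h0 n (fun i _ => hsucc i) (ε := ε * n) (by positivity)
  refine hazuma.trans_eq ?_
  rw [← Real.exp_nat_mul]
  rcases n.eq_zero_or_pos with rfl | hn
  · simp
  · congr 1
    simp only [Finset.sum_const, Finset.card_range, nsmul_eq_mul, mul_one, NNReal.coe_natCast]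
    field_simp

end Azuma

section BorelCantelli

theorem measureReal_exists_ge_le_of_le_pow {Ω : Type*} [MeasurableSpace Ω] {μ : Measure Ω}
    [IsFiniteMeasure μ] {S : ℕ → Set Ω} {r : ℝ} (hr0 : 0 ≤ r) (hr : r < 1)
    (hS : ∀ n, μ.real (S n) ≤ r ^ n) (m : ℕ) :
    μ.real {ω | ∃ n ≥ m, ω ∈ S n} ≤ (1 - r)⁻¹ * r ^ m := by
  have hpow (n : ℕ) : μ (S n) ≤ ENNReal.ofReal (r ^ n) :=
    (ENNReal.le_ofReal_iff_toReal_le (measure_ne_top _ _) (by positivity)).2 (hS n)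
  have hsummable : Summable fun k => r ^ m * r ^ k :=
    (summable_geometric_of_lt_one hr0 hr).mul_left _
  have hcover : {ω | ∃ n ≥ m, ω ∈ S n} ⊆ ⋃ k, S (m + k) := by
    rintro ω ⟨n, hn, hω⟩
    exact Set.mem_iUnion.2 ⟨n - m, by rwa [Nat.add_sub_cancel' hn]⟩
  refine ENNReal.toReal_le_of_le_ofReal
    (mul_nonneg (inv_nonneg.2 (sub_nonneg.2 hr.le)) (by positivity)) ?_
  calc μ {ω | ∃ n ≥ m, ω ∈ S n} ≤ ∑' k, μ (S (m + k)) :=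
        (measure_mono hcover).trans (measure_iUnion_le _)
    _ ≤ ∑' k, ENNReal.ofReal (r ^ m * r ^ k) :=
        ENNReal.tsum_le_tsum fun k => (hpow _).trans_eq (by rw [pow_add])
    _ = ENNReal.ofReal ((1 - r)⁻¹ * r ^ m) := by
        rw [← ENNReal.ofReal_tsum_of_nonneg (fun k => by positivity) hsummable, tsum_mul_left,
          tsum_geometric_of_lt_one hr0 hr, mul_comm]

variable {s x : BiSeq D} {P : ProbabilityMeasure (BiSeq D)}

theorem IsOneRandomWith.eventually_not_block_of_le_pow (hx : IsOneRandomWith s P x)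
    {Z : List (Fin D) → Prop} (hZ : CEIn s Z) {r : ℝ} (hr0 : 0 ≤ r) (hr : r < 1)
    (hbound : ∀ n, (P : Measure (BiSeq D)).real {y | Z (block y 1 n)} ≤ r ^ n) :
    ∀ᶠ n : ℕ in atTop, ¬ Z (block x 1 n) := by
  obtain ⟨V, hV, hVopen⟩ := hZ.exists_openSet_eq_exists_ge (j := fun _ => 1)
    (o := fun k _ => k + 1) (Primrec.succ.comp Primrec.fst) (by omega) (by omega)
  obtain ⟨m, hm⟩ := hx.exists_notMem_of_le_geometric hV hr0 hr fun m =>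
    hVopen m ▸ measureReal_exists_ge_le_of_le_pow hr0 hr hbound m
  rw [hVopen] at hm
  exact eventually_atTop.2 ⟨m, fun n hn hZn => hm ⟨n, hn, hZn⟩⟩

end BorelCantelli

section Hits

theorem computable_sum_range {α : Type*} [Primcodable α] {g : α → ℕ → ℕ} {n : α → ℕ}
    (hg : Computable₂ g) (hn : Computable n) :
    Computable fun a => ∑ i ∈ Finset.range (n a), g a i := by
  refine (Computable.nat_rec hn (Computable.const 0) (h := fun a z => z.2 + g a z.1)
    (Primrec.nat_add.to_comp.comp (Computable.snd.comp .snd)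
      (hg.comp .fst (Computable.fst.comp .snd)))).of_eq fun a => ?_
  induction n a with
  | zero => rfl
  | succ k ih => exact (congrArg (· + g a k) ih).trans (Finset.sum_range_succ _ _).symm

theorem CEIn.exists_le_sum {α : Type*} [Primcodable α] {s : BiSeq D} {S : (α × ℕ) × ℕ → Prop}
    (hS : CEIn s S) {n N : α → ℕ} (hn : Computable n) (hN : Computable N) :
    CEIn s fun a => ∃ e : ℕ → ℕ, (∀ i < n a, S ((a, i), e i)) ∧
      N a ≤ ∑ i ∈ Finset.range (n a), e i := by
  have hlt : CEIn s fun z : α × List ℕ => ∀ i < n z.1, S ((z.1, i), z.2.getD i 0) :=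
    (CEIn.forall_lt (A := fun q : (α × List ℕ) × ℕ => S ((q.1.1, q.2), q.1.2.getD q.2 0))
      (hS.comp (((Primrec.fst.comp .fst).pair .snd).pair
        ((Primrec.list_getD 0).comp (Primrec.snd.comp .fst) .snd)).to_comp)).comp
      (Computable.id.pair (hn.comp .fst))
  have hsum : Computable₂ fun (z : α × List ℕ) i => z.2.getD i 0 :=
    ((Primrec.list_getD 0).comp (Primrec.snd.comp .fst) .snd).to_comp
  have hle : CEIn s fun z : α × List ℕ => N z.1 ≤ ∑ i ∈ Finset.range (n z.1), z.2.getD i 0 :=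
    CEIn.comp (.of_primrecPred Primrec.nat_le)
      ((hN.comp .fst).pair (computable_sum_range hsum (hn.comp .fst)))
  refine (hlt.and hle).ex.of_iff fun a => ⟨fun ⟨l, h⟩ => ⟨_, h⟩, ?_⟩
  rintro ⟨e, hS, hN⟩
  have hget {i : ℕ} (hi : i < n a) : ((List.range (n a)).map e).getD i 0 = e i := by
    simp [hi]
  refine ⟨(List.range (n a)).map e, fun i hi => (hget hi).symm ▸ hS i hi, hN.trans_eq ?_⟩
  exact Finset.sum_congr rfl fun i hi => (hget (Finset.mem_range.1 hi)).symm

/-- The number of letters of `w` that the predictor `f` predicts correctly from the letters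
before them. -/
def hitCount (f : List (Fin D) → Fin D) (w : List (Fin D)) : ℕ :=
  ∑ i ∈ Finset.range w.length, if w[i]? = some (f (w.take i)) then 1 else 0

theorem computable_hitCount {f : List (Fin D) → Fin D} (hf : Computable f) :
    Computable (hitCount f) := by
  have hindicator : Primrec fun o : Option (Fin D) × Option (Fin D) => if o.1 = o.2 then 1 else 0 :=
    .ite (Primrec.eq.comp .fst .snd) (.const 1) (.const 0)
  exact computable_sum_range (hindicator.to_comp.comp
    ((Computable.list_getElem?.comp .fst .snd).pair (Computable.option_some.comp (hf.comp
      (Primrec.list_take.comp .snd .fst).to_comp)))) Computable.list_length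

theorem take_block (x : BiSeq D) (j : ℤ) {i n : ℕ} (hi : i ≤ n) :
    (block x j n).take i = block x j i := by
  simpa using take_drop_block x j (k := 0) ((Nat.zero_add i).trans_le hi)

theorem hitCount_block (f : List (Fin D) → Fin D) (x : BiSeq D) (n : ℕ) :
    hitCount f (block x 1 n) =
      ∑ i ∈ Finset.range n, if x ((i : ℤ) + 1) = f (block x 1 i) then 1 else 0 := by
  rw [hitCount, length_block]
  refine Finset.sum_congr rfl fun i hi => ?_
  have hin := Finset.mem_range.1 hi
  rw [take_block x 1 hin.le, block_eq_map, List.getElem?_map, List.getElem?_range hin]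
  simp [add_comm]

end Hits

section Predictor

variable {s x : BiSeq D} {P : ProbabilityMeasure (BiSeq D)} {f : List (Fin D) → Fin D}

/-- The σ-fields generated by the letters `x_1, ..., x_n`. -/
def initialFiltration (D : ℕ) : Filtration ℕ (inferInstance : MeasurableSpace (BiSeq D)) where
  seq n := MeasurableSpace.comap (fun x : BiSeq D => block x 1 n) ⊤
  mono' m n hmn := by
    rintro _ ⟨A, -, rfl⟩
    refine ⟨(List.take m) ⁻¹' A, trivial, ?_⟩
    ext x
    simp only [Set.mem_preimage, take_block x 1 hmn]
  le' n := by
    rintro _ ⟨A, -, rfl⟩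
    exact measurableSet_block_mem _ _ A

theorem measurable_initialFiltration_block {α : Type*} [MeasurableSpace α]
    (φ : List (Fin D) → α) (n : ℕ) :
    Measurable[initialFiltration D n] fun x : BiSeq D => φ (block x 1 n) :=
  fun A _ => ⟨φ ⁻¹' A, trivial, rfl⟩

/-- The event that the predictor `f` predicts the letter `x_{n+1}` correctly. -/
def hitEvent (f : List (Fin D) → Fin D) (n : ℕ) : Set (BiSeq D) :=
  {x | x ((n : ℤ) + 1) = f (block x 1 n)}

theorem measurableSet_initialFiltration_hitEvent (f : List (Fin D) → Fin D) (n : ℕ) :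
    MeasurableSet[initialFiltration D (n + 1)] (hitEvent f n) := by
  refine ⟨{w | w = w.take n ++ [f (w.take n)]}, trivial, ?_⟩
  ext x
  rw [Set.mem_preimage, Set.mem_ofPred_eq, take_block x 1 n.le_succ, block_succ,
    List.append_cancel_left_eq, List.singleton_inj, hitEvent, Set.mem_ofPred_eq, add_comm]

theorem condProb_predictor_ae_eq_condExp (P : ProbabilityMeasure (BiSeq D))
    (f : List (Fin D) → Fin D) (n : ℕ) :
    (fun x => condProb P 1 (block x 1 n) (f (block x 1 n))) =ᵐ[(P : Measure (BiSeq D))]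
      (P : Measure (BiSeq D))[(hitEvent f n).indicator 1 | initialFiltration D n] := by
  refine (EventuallyEq.of_eq (funext fun x => ?_)).trans (ae_eq_condExp_indicator_comap
    (g := fun x : BiSeq D => block x 1 n) (measurableSet_block_mem _ n)
    ((initialFiltration D).le _ _ (measurableSet_initialFiltration_hitEvent f n)))
  rw [condProb, blockProb, blockProb, length_block]
  congr 2
  ext y
  have hiff := block_length_append_singleton_iff y 1 (block x 1 n) (f (block x 1 n))
  rw [length_block] at hiff
  refine hiff.trans (and_congr_right fun hy => ?_)
  rw [hitEvent, Set.mem_ofPred_eq, hy, add_comm]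

theorem condExp_condProb_predictor_sub_indicator (P : ProbabilityMeasure (BiSeq D))
    (f : List (Fin D) → Fin D) (n : ℕ) :
    (P : Measure (BiSeq D))[fun x => condProb P 1 (block x 1 n) (f (block x 1 n)) -
      (hitEvent f n).indicator 1 x | initialFiltration D n] =ᵐ[(P : Measure (BiSeq D))] 0 := by
  have hle := (initialFiltration D).le n
  have hpred := condProb_predictor_ae_eq_condExp P f n
  have hindInt : Integrable ((hitEvent f n).indicator (1 : BiSeq D → ℝ)) (P : Measure (BiSeq D)) :=
    (integrable_const 1).indicator
      ((initialFiltration D).le _ _ (measurableSet_initialFiltration_hitEvent f n))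
  have hpredInt := (integrable_congr hpred).2 integrable_condExp
  have hpredCond := condExp_of_stronglyMeasurable hle (measurable_initialFiltration_block
    (fun w => condProb P 1 w (f w)) n).stronglyMeasurable hpredInt
  filter_upwards [condExp_sub hpredInt hindInt (initialFiltration D n), hpred] with x hsub hx
  refine hsub.trans ?_
  rw [Pi.sub_apply, hpredCond, ← hx, sub_self, Pi.zero_apply]

theorem measureReal_hitCount_le_sum_condProb_le (P : ProbabilityMeasure (BiSeq D))
    (f : List (Fin D) → Fin D) {ε : ℝ} (hε : 0 ≤ ε) (n : ℕ) :
    (P : Measure (BiSeq D)).real {x | hitCount f (block x 1 n) + ε * n ≤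
      ∑ i ∈ Finset.range n, condProb P 1 (block x 1 i) (f (block x 1 i))} ≤
      Real.exp (-ε ^ 2 / 2) ^ n := by
  have hmem (i : ℕ) (x : BiSeq D) : condProb P 1 (block x 1 i) (f (block x 1 i)) -
      (hitEvent f i).indicator 1 x ∈ Set.Icc (-1) 1 := by
    have h0 := condProb_nonneg (P := P) 1 (block x 1 i) (f (block x 1 i))
    have h1 := condProb_le_one (P := P) 1 (block x 1 i) (f (block x 1 i))
    by_cases hx : x ∈ hitEvent f i
    · simp [hx, h0, h1.trans (by norm_num : (1 : ℝ) ≤ 1 + 1)]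
    · simp [hx, h1, (neg_nonpos.2 zero_le_one).trans h0]
  refine le_of_eq_of_le ?_ (measureReal_le_sum_le_exp (μ := (P : Measure (BiSeq D)))
    (fun i => ?_) hmem (condExp_condProb_predictor_sub_indicator P f) hε n)
  · classical
    congr 1
    ext x
    simp only [Set.mem_ofPred_eq, Finset.sum_sub_distrib, hitCount_block, Set.indicator_apply,
      hitEvent, Pi.one_apply]
    push_cast
    rw [le_sub_iff_add_le']
  · have hpred := (measurable_initialFiltration_block (fun w => condProb P 1 w (f w)) i).mono
      ((initialFiltration D).mono i.le_succ) le_rfl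
    have hind : Measurable[initialFiltration D (i + 1)]
        ((hitEvent f i).indicator (1 : BiSeq D → ℝ)) :=
      Measurable.indicator measurable_const (measurableSet_initialFiltration_hitEvent f i)
    exact Measurable.sub (m := initialFiltration D (i + 1)) hpred hind

/-- The predictor `f` is visibly less successful on `w` than expected: the numbers `e i`, which are
lower bounds for `M` times the probabilities of the predicted letters, exceed `M` times the number
of correct predictions by `|w|`. -/
def HasDeficit (P : ProbabilityMeasure (BiSeq D)) (f : List (Fin D) → Fin D) (M : ℕ)
    (w : List (Fin D)) : Prop :=
  ∃ e : ℕ → ℕ, (∀ i < w.length, e i = 0 ∨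
    e i * blockProb P 1 (w.take i) < M * blockProb P 1 (w.take i ++ [f (w.take i)])) ∧
      M * hitCount f w + w.length ≤ ∑ i ∈ Finset.range w.length, e i

theorem IsRepresentation.ceIn_hasDeficit (hs : IsRepresentation s P) (hf : Computable f) (M : ℕ) :
    CEIn s (HasDeficit P f M) := by
  have htake : Computable fun z : (List (Fin D) × ℕ) × ℕ => z.1.1.take z.1.2 :=
    (Primrec.list_take.comp (Primrec.snd.comp .fst) (Primrec.fst.comp .fst)).to_comp
  have hsingleton : Computable fun w : List (Fin D) => [w] :=
    (Primrec.list_cons.comp .id (.const [])).to_comp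
  have hbelow : CEIn s fun z : (List (Fin D) × ℕ) × ℕ => z.2 * blockProb P 1 (z.1.1.take z.1.2) <
      M * blockProb P 1 (z.1.1.take z.1.2 ++ [f (z.1.1.take z.1.2)]) := by
    simpa only [List.map_singleton, List.sum_singleton] using hs.ceIn_mul_sum_blockProb_lt
      .snd (hsingleton.comp htake) (.const M)
      (hsingleton.comp (Computable.list_concat.comp htake (hf.comp htake)))
  exact CEIn.exists_le_sum ((CEIn.of_primrecPred (Primrec.eq.comp .snd (.const 0))).or hbelow)
    .list_length (Primrec.nat_add.to_comp.comp
      (Primrec.nat_mul.to_comp.comp (.const M) (computable_hitCount hf)) .list_length)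

theorem mul_blockProb_lt_iff {w : List (Fin D)} (hw : 0 < blockProb P 1 w) (a : Fin D) (e M : ℕ) :
    e * blockProb P 1 w < M * blockProb P 1 (w ++ [a]) ↔ e < M * condProb P 1 w a := by
  rw [condProb, ← mul_div_assoc, lt_div_iff₀ hw]

theorem HasDeficit.hitCount_add_le {M : ℕ} (hM : 0 < M) {y : BiSeq D} {n : ℕ}
    (h : HasDeficit P f M (block y 1 n)) :
    hitCount f (block y 1 n) + (M : ℝ)⁻¹ * n ≤
      ∑ i ∈ Finset.range n, condProb P 1 (block y 1 i) (f (block y 1 i)) := by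
  obtain ⟨e, he, hsum⟩ := h
  rw [length_block] at he hsum
  have hbound : ∀ i ∈ Finset.range n,
      (e i : ℝ) ≤ M * condProb P 1 (block y 1 i) (f (block y 1 i)) := by
    intro i hi
    have hi' := Finset.mem_range.1 hi
    specialize he i hi'
    rw [take_block y 1 hi'.le] at he
    rcases he with h0 | hlt
    · rw [h0, Nat.cast_zero]
      exact mul_nonneg M.cast_nonneg (condProb_nonneg 1 _ _)
    · rcases (blockProb_nonneg P 1 (block y 1 i)).eq_or_lt with h0 | hpos
      · have hzero := (blockProb_append_singleton_le (P := P) 1 (block y 1 i)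
          (f (block y 1 i))).trans_eq h0.symm
        rw [← h0, mul_zero] at hlt
        exact absurd hlt (mul_nonpos_of_nonneg_of_nonpos M.cast_nonneg hzero).not_gt
      · exact ((mul_blockProb_lt_iff hpos _ _ _).1 hlt).le
  have hM' : (0 : ℝ) < M := Nat.cast_pos.2 hM
  refine le_of_mul_le_mul_left ?_ hM'
  calc M * (hitCount f (block y 1 n) + (M : ℝ)⁻¹ * n)
      = ((M * hitCount f (block y 1 n) + n : ℕ) : ℝ) := by
        push_cast
        field_simp
    _ ≤ ∑ i ∈ Finset.range n, (e i : ℝ) := by exact_mod_cast hsum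
    _ ≤ M * ∑ i ∈ Finset.range n, condProb P 1 (block y 1 i) (f (block y 1 i)) := by
        rw [Finset.mul_sum]
        exact Finset.sum_le_sum hbound

theorem IsOneRandomWith.hasDeficit (hx : IsOneRandomWith s P x) {ε : ℝ} {M : ℕ} (hM : 2 ≤ M * ε)
    {n : ℕ} (h : hitCount f (block x 1 n) + ε * n <
      ∑ i ∈ Finset.range n, condProb P 1 (block x 1 i) (f (block x 1 i))) :
    HasDeficit P f M (block x 1 n) := by
  let t (i : ℕ) : ℝ := M * condProb P 1 (block x 1 i) (f (block x 1 i))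
  refine ⟨fun i => ⌈t i⌉₊ - 1, fun i hi => ?_, ?_⟩
  · rw [length_block] at hi
    rw [take_block x 1 hi.le, mul_blockProb_lt_iff (hx.blockProb_pos i)]
    rcases Nat.eq_zero_or_pos (⌈t i⌉₊ - 1) with h0 | hpos
    · exact .inl h0
    · exact .inr (Nat.lt_ceil.1 (show ⌈t i⌉₊ - 1 < ⌈t i⌉₊ by omega))
  · rw [length_block, ← Nat.cast_le (α := ℝ)]
    have hceil (i : ℕ) : t i - 1 ≤ (⌈t i⌉₊ - 1 : ℕ) :=
      sub_le_iff_le_add.2 ((Nat.le_ceil _).trans (by exact_mod_cast (by omega)))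
    have hMn : 2 * (n : ℝ) ≤ M * ε * n := by gcongr
    have hMlt := mul_le_mul_of_nonneg_left h.le M.cast_nonneg
    rw [mul_add, Finset.mul_sum] at hMlt
    push_cast
    calc (M * hitCount f (block x 1 n) + n : ℝ)
        ≤ ∑ i ∈ Finset.range n, (t i - 1) := by
          simp only [t, Finset.sum_sub_distrib, Finset.sum_const, Finset.card_range, nsmul_eq_mul]
          linarith
      _ ≤ ∑ i ∈ Finset.range n, ((⌈t i⌉₊ - 1 : ℕ) : ℝ) := Finset.sum_le_sum fun i _ => hceil i

theorem IsOneRandomWith.eventually_sum_condProb_le (hx : IsOneRandomWith s P x)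
    (hs : IsRepresentation s P) (hf : Computable f) {ε : ℝ} (hε : 0 < ε) :
    ∀ᶠ n : ℕ in atTop, ∑ i ∈ Finset.range n, condProb P 1 (block x 1 i) (f (block x 1 i)) ≤
      hitCount f (block x 1 n) + ε * n := by
  obtain ⟨M, hM⟩ := exists_nat_gt (2 / ε)
  have hM0 : 0 < M := by exact_mod_cast (by positivity : 0 < 2 / ε).trans hM
  have hMε : 2 ≤ M * ε := ((div_lt_iff₀ hε).1 hM).le
  have hr : Real.exp (-(M : ℝ)⁻¹ ^ 2 / 2) < 1 := by
    rw [Real.exp_lt_one_iff, neg_div, neg_lt_zero]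
    positivity
  have hbound (n : ℕ) : (P : Measure (BiSeq D)).real {y | HasDeficit P f M (block y 1 n)} ≤
      Real.exp (-(M : ℝ)⁻¹ ^ 2 / 2) ^ n :=
    (measureReal_mono fun y hy => HasDeficit.hitCount_add_le hM0 hy).trans
      (measureReal_hitCount_le_sum_condProb_le P f (by positivity) n)
  filter_upwards [hx.eventually_not_block_of_le_pow (hs.ceIn_hasDeficit hf M) (Real.exp_nonneg _)
    hr hbound] with n hn
  exact not_lt.1 fun h => hn (hx.hasDeficit hMε h)

end Predictor

section Universality

variable {s x : BiSeq D} {P : ProbabilityMeasure (BiSeq D)} {f : List (Fin D) → Fin D}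

theorem sum_blockProb_append_singleton (j : ℤ) (w : List (Fin D)) :
    ∑ a, blockProb P j (w ++ [a]) = blockProb P j w := by
  have hunion : ⋃ a, {x : BiSeq D | block x j (w ++ [a]).length = w ++ [a]} =
      {x | block x j w.length = w} := by
    ext x
    simp only [Set.mem_iUnion, Set.mem_ofPred_eq, block_length_append_singleton_iff,
      exists_and_left, exists_eq', and_true]
  rw [blockProb, ← hunion]
  refine (measureReal_iUnion_fintype (fun a b hab => Set.disjoint_left.2 fun x hxa hxb => hab ?_)
    fun a => measurableSet_block_eq j _ _).symm
  exact ((block_length_append_singleton_iff x j w a).1 hxa).2.symm.trans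
    ((block_length_append_singleton_iff x j w b).1 hxb).2

theorem sum_condProb_eq_one {j : ℤ} {w : List (Fin D)} (hw : 0 < blockProb P j w) :
    ∑ a, condProb P j w a = 1 := by
  simp only [condProb, ← Finset.sum_div, sum_blockProb_append_singleton, div_self hw.ne']

theorem IsOneRandomWith.sum_sum_condProb_add [NeZero D] (hx : IsOneRandomWith s P x) (n : ℕ) :
    ∑ k, ∑ i ∈ Finset.range n, condProb P 1 (block x 1 i) (f (block x 1 i) + k) = n := by
  rw [Finset.sum_comm]
  refine (Finset.sum_congr rfl fun i _ => ?_).trans (Finset.sum_const (1 : ℝ)) |>.trans (by simp)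
  exact (Equiv.sum_comp (Equiv.addLeft (f (block x 1 i))) (condProb P 1 (block x 1 i))).trans
    (sum_condProb_eq_one (hx.blockProb_pos i))

theorem sum_hitCount_add [NeZero D] (f : List (Fin D) → Fin D) (x : BiSeq D) (n : ℕ) :
    ∑ k, hitCount (fun w => f w + k) (block x 1 n) = n := by
  simp only [hitCount_block]
  rw [Finset.sum_comm]
  simp [← sub_eq_iff_eq_add']

theorem sum_ite_ne_eq_sub_hitCount (f : List (Fin D) → Fin D) (x : BiSeq D) (n : ℕ) :
    ∑ i ∈ Finset.range n, (if x ((i : ℤ) + 1) ≠ f (block x 1 i) then (1 : ℝ) else 0) =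
      n - hitCount f (block x 1 n) := by
  have hterm (i : ℕ) : (if x ((i : ℤ) + 1) ≠ f (block x 1 i) then (1 : ℝ) else 0) =
      1 - if x ((i : ℤ) + 1) = f (block x 1 i) then (1 : ℝ) else 0 := by
    split_ifs <;> simp_all
  rw [hitCount_block, Finset.sum_congr rfl fun i _ => hterm i, Finset.sum_sub_distrib]
  simp

theorem IsOneRandomWith.eventually_hitCount_le [NeZero D] (hx : IsOneRandomWith s P x)
    (hs : IsRepresentation s P) (hf : Computable f) {ε : ℝ} (hε : 0 < ε) :
    ∀ᶠ n : ℕ in atTop, hitCount f (block x 1 n) ≤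
      ∑ i ∈ Finset.range n, condProb P 1 (block x 1 i) (f (block x 1 i)) + ε * n := by
  have hD : (0 : ℝ) < D := Nat.cast_pos.2 (NeZero.pos D)
  have hshift (k : Fin D) : Computable fun w => f w + k :=
    (Primrec.dom_finite (· + k)).to_comp.comp hf
  filter_upwards [eventually_all.2 fun k =>
    hx.eventually_sum_condProb_le hs (hshift k) (div_pos hε hD)] with n hn
  have hsum := Finset.sum_le_sum fun k (_ : k ∈ Finset.univ.erase (0 : Fin D)) => hn k
  have hcond := hx.sum_sum_condProb_add (f := f) n
  have hhit : ∑ k, (hitCount (fun w => f w + k) (block x 1 n) : ℝ) = n := by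
    exact_mod_cast sum_hitCount_add f x n
  rw [← Finset.add_sum_erase _ _ (Finset.mem_univ 0)] at hcond hhit
  simp only [add_zero] at hcond hhit
  have hcard : ((Finset.univ.erase (0 : Fin D)).card : ℝ) * (ε / D * n) ≤ ε * n := by
    rw [← mul_assoc]
    gcongr
    rw [mul_div_left_comm]
    refine mul_le_of_le_one_right hε.le ((div_le_one hD).2 ?_)
    exact_mod_cast (Finset.card_erase_le).trans_eq (Finset.card_fin D)
  rw [Finset.sum_add_distrib, Finset.sum_const, nsmul_eq_mul] at hsum
  linarith

theorem IsOneRandomWith.tendsto_average_condProb_sub_hitCount [NeZero D]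
    (hx : IsOneRandomWith s P x) (hs : IsRepresentation s P) (hf : Computable f) :
    Tendsto (fun n : ℕ => (1 / (n : ℝ)) *
      (∑ i ∈ Finset.range n, condProb P 1 (block x 1 i) (f (block x 1 i)) -
        hitCount f (block x 1 n))) atTop (𝓝 0) := by
  rw [Metric.tendsto_nhds]
  intro ε hε
  filter_upwards [hx.eventually_sum_condProb_le hs hf (half_pos hε),
    hx.eventually_hitCount_le hs hf (half_pos hε), eventually_gt_atTop 0] with n hle hge hn
  have hn' : (0 : ℝ) < n := Nat.cast_pos.2 hn
  have hεn : 0 < ε * n := mul_pos hε hn'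
  rw [Real.dist_eq, sub_zero, one_div_mul_eq_div, abs_div, abs_of_pos hn', div_lt_iff₀ hn', abs_lt]
  constructor <;> linarith

theorem maxCondProb_le_condProb_add_sum_abs_sub [NeZero D] {g : Fin D → ℝ} {a : Fin D}
    (ha : ∀ b, g b ≤ g a) (w : List (Fin D)) :
    maxCondProb P w ≤ condProb P 1 w a + 2 * ∑ b, |g b - condProb P 1 w b| := by
  obtain ⟨b, hb⟩ := exists_condProb_eq_maxCondProb (P := P) w
  have hle (c : Fin D) : |g c - condProb P 1 w c| ≤ ∑ b, |g b - condProb P 1 w b| :=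
    Finset.single_le_sum (f := fun b => |g b - condProb P 1 w b|) (fun _ _ => abs_nonneg _)
      (Finset.mem_univ c)
  linarith [(abs_le.1 (hle b)).1, (abs_le.1 (hle a)).2, ha b]

theorem tendsto_average_maxCondProb_sub [NeZero D] {q : List (Fin D) → Fin D → ℝ}
    (hq : Tendsto (fun n : ℕ => (1 / (n : ℝ)) * ∑ i ∈ Finset.range n, ∑ a,
      |q (block x 1 i) a - condProb P 1 (block x 1 i) a|) atTop (𝓝 0))
    (hfq : ∀ w b, q w b ≤ q w (f w)) :
    Tendsto (fun n : ℕ => (1 / (n : ℝ)) * ∑ i ∈ Finset.range n, (maxCondProb P (block x 1 i) -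
      condProb P 1 (block x 1 i) (f (block x 1 i)))) atTop (𝓝 0) := by
  have hq2 := hq.const_mul 2
  rw [mul_zero] at hq2
  refine squeeze_zero (fun n => ?_) (fun n => ?_) hq2
  · exact mul_nonneg (by positivity) (Finset.sum_nonneg fun i _ =>
      sub_nonneg.2 (condProb_le_maxCondProb _ _))
  · rw [mul_left_comm, Finset.mul_sum _ _ (2 : ℝ)]
    gcongr with i
    exact sub_le_iff_le_add'.2 (maxCondProb_le_condProb_add_sum_abs_sub (hfq _) _)

theorem isUnpredictabilityRate_of_tendsto (hP : MeasurePreserving shift (P : Measure (BiSeq D)) P)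
    {G : BiSeq D → ℝ} (hlim : ∀ᵐ y ∂(P : Measure (BiSeq D)),
      Tendsto (fun n : ℕ => maxCondProb P (block y (-(n : ℤ)) n)) atTop (𝓝 (G y))) :
    IsUnpredictabilityRate P (1 - ∫ y, G y ∂(P : Measure (BiSeq D))) := by
  have hmeas (n : ℕ) : AEStronglyMeasurable (fun y => maxCondProb P (block y (-(n : ℤ)) n))
      (P : Measure (BiSeq D)) :=
    Measurable.aestronglyMeasurable fun A _ => measurableSet_block_mem _ n (maxCondProb P ⁻¹' A)
  have hbound (n : ℕ) (y : BiSeq D) : ‖maxCondProb P (block y (-(n : ℤ)) n)‖ ≤ 1 := by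
    rw [Real.norm_of_nonneg (maxCondProb_nonneg _)]
    exact maxCondProb_le_one _
  refine ((tendsto_integral_of_dominated_convergence _ hmeas (integrable_const 1)
    (fun n => ae_of_all _ (hbound n)) hlim).const_sub 1).congr fun n => ?_
  simp only [condProb_eq_condProb_one hP]
  refine Eq.trans ?_ (integral_sub (integrable_const 1)
    (.of_bound (hmeas n) 1 (ae_of_all _ (hbound n)))).symm
  rw [integral_const, probReal_univ, one_smul]

theorem le_argmax [NeZero D] (g : Fin D → ℝ) (b : Fin D) : g b ≤ g (argmax g) := by
  classical
  exact (Finset.mem_filter.1 (Finset.min'_mem (Finset.univ.filter fun a => ∀ b, g b ≤ g a) _)).2 b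

end Universality

end UniversalPrediction

open UniversalPrediction Filter Topology MeasureTheory in
theorem mainTheorem3_general {D : ℕ} {q : List (Fin D) → Fin D → ℝ} {f : List (Fin D) → Fin D}
    (hq : ∀ P : ProbabilityMeasure (BiSeq D), StationaryErgodic P → ∀ x, IsOneRandom P x →
      Tendsto (fun n : ℕ => (1 / (n : ℝ)) * ∑ i ∈ Finset.range n, ∑ a,
        |q (block x 1 i) a - condProb P 1 (block x 1 i) a|) atTop (𝓝 0))
    (hf : Computable f) (hfq : ∀ w b, q w b ≤ q w (f w)) : IsOneUniversalPredictor f := by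
  have : NeZero D := ⟨fun hD => by subst hD; exact (f []).elim0⟩
  refine ⟨hf, fun P hP => ?_⟩
  obtain ⟨G, hG, hlim⟩ := exists_measurable_tendsto_maxCondProb hP.toMeasurePreserving
  refine ⟨_, isUnpredictabilityRate_of_tendsto hP.toMeasurePreserving hlim, fun x hx => ?_⟩
  have hgap := tendsto_average_maxCondProb_sub (hq P hP x hx) hfq
  obtain ⟨s, hs, hx⟩ := hx
  have hmax := hx.tendsto_average_maxCondProb hs hP hG hlim
  have hhit := hx.tendsto_average_condProb_sub_hitCount hs hf
  have hmiss := ((hmax.const_sub 1).add hgap).add hhit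
  rw [add_zero, add_zero] at hmiss
  refine hmiss.congr' ?_
  filter_upwards [eventually_ne_atTop 0] with n hn
  rw [sum_ite_ne_eq_sub_hitCount, Finset.sum_sub_distrib, mul_sub, mul_sub, mul_sub,
    one_div_mul_cancel (Nat.cast_ne_zero.2 hn)]
  ring

theorem mainTheorem3 (D : ℕ) [NeZero D] (hD : 2 ≤ D)
    (R : MeasureTheory.ProbabilityMeasure (UniversalPrediction.BiSeq D))
    (hR : UniversalPrediction.IsOneUniversalForwardEstimator R)
    (hf : Computable (UniversalPrediction.inducedPredictor R)) :
    UniversalPrediction.IsOneUniversalPredictor (UniversalPrediction.inducedPredictor R) :=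
  mainTheorem3_general hR.2 hf fun _ => UniversalPrediction.le_argmax _
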